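/- **Theorem 1.** Let $S$ be a connected orientable smooth surface and let $r:S\to\mathbb{R}^3\setminus\{0\}$ be an isometric immersion (equivalently, a smooth immersion, with $S$ carrying the induced metric). We say that $S$ has slope $\theta$ if, for a suitable choice of the smooth unit normal field $N$ along $r$, the angle between $N(p)$ and the position vector $r(p)$ equals $\theta$ at every $p\in S$; $S$ is of constant slope if it has slope $\theta$ for some $\theta\in[0,\pi)$. For $\theta\in(0,\pi)$ we say that an immersion $\rho:S\to\mathbb{R}^3$ is of type $(\ast_\theta)$ near $p\in S$ if there are a smooth unit speed curve $f$ on the unit sphere $\mathbb{S}^2$, defined on an open interval, and smooth local coordinates $(u,v)$, $u>0$, of $S$ around $p$ in which $$\rho(u,v)=u\sin\theta\,\bigl(\cos\xi\, f(v)+\sin\xi\, f(v)\times f'(v)\bigr),\qquad \xi=\xi(u)=\cot\theta\,\log u .$$ 1. $S$ is of constant slope if and only if either $r(S)$ is an open part of a sphere centered at the origin, or there is $\theta\in(0,\pi)$ such that, locally and up to a homothety, $r$ is given by $(\ast_\theta)$: for every $p\in S$ there is $c>0$ such that $c\,r$ is of type $(\ast_\theta)$ near $p$. 2. More precisely, $S$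 has slope $0$ if and only if $r(S)$ is an open part of a sphere centered at the origin; and for $\theta\in(0,\pi)$, $S$ has slope $\theta$ if and only if for every $p\in S$ there is $c>0$ such that $c\,r$ is of type $(\ast_\theta)$ near $p$. 3. Almost every homothety will do: if $S$ has slope $\theta\in(0,\pi)$, $p\in S$, and $a,b>0$ are such that $\cot\theta\,(\log a-\log b)\notin\pi\mathbb{Z}$, then $a\,r$ or $b\,r$ is of type $(\ast_\theta)$ near $p$. 4. For $\theta=\pi/2$ no homothety is needed: $S$ has slope $\pi/2$ if and only if $r$ is of type $(\ast_{\pi/2})$ near every point. Equivalently, every point of $S$ has a neighbourhood with smooth coordinates $(u,v)$, $u>0$, in which $r(u,v)=u f(v)$ for a smooth unit speed curve $f$ on $\mathbb{S}^2$, and whose image is either an open part of a plane through the origin or a piece of a cone with vertex at the origin lying in no such plane. Conversely, if $r(S)$ is contained in a plane through the origin, then $S$ has slope $\pi/2$. -/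

import Mathlib

open scoped Manifold ContDiff Matrix
open Set

/-- Euclidean 3-space. -/
abbrev E3 : Type := EuclideanSpace ℝ (Fin 3)

/-- The model plane of the coordinates `(u, v)`. -/
abbrev E2 : Type := EuclideanSpace ℝ (Fin 2)

/-- The vector product of Euclidean 3-space. -/
noncomputable def cross3 (a b : E3) : E3 := WithLp.toLp 2 (a.ofLp ⨯₃ b.ofLp)

/-- `A` is an open part of the set `B`: a relatively open subset of `B`. -/
def IsOpenPart (A B : Set E3) : Prop := ∃ O : Set E3, IsOpen O ∧ A = O ∩ B

/-- `f` is a smooth unit speed curve on the unit sphere, defined on the open interval `J`. -/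
structure IsUnitSpeedSphereCurve (J : Set ℝ) (f : ℝ → E3) : Prop where
  isOpen : IsOpen J
  ordConnected : J.OrdConnected
  smooth : ContDiffOn ℝ ∞ f J
  on_sphere : ∀ v ∈ J, ‖f v‖ = 1
  unit_speed : ∀ v ∈ J, ‖deriv f v‖ = 1

/-- `r(u,v) = u sin θ (cos ξ f(v) + sin ξ f(v) × f'(v))`, where `ξ = cot θ log u`. -/
noncomputable def slopeMap (θ : ℝ) (f : ℝ → E3) (u v : ℝ) : E3 :=
  (u * Real.sin θ) •
    (Real.cos (Real.cot θ * Real.log u) • f v +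
      Real.sin (Real.cot θ * Real.log u) • cross3 (f v) (deriv f v))

section Surfaces

variable {S : Type*} [TopologicalSpace S] [ChartedSpace E2 S]

/-- `r` is a smooth immersion of the surface `S` in Euclidean 3-space. -/
structure IsSurfaceImmersion (r : S → E3) : Prop where
  smooth : ContMDiff (𝓡 2) 𝓘(ℝ, E3) ∞ r
  injective_mfderiv : ∀ p : S, Function.Injective (mfderiv (𝓡 2) 𝓘(ℝ, E3) r p)

/-- `N` is a smooth unit normal field along `r`. -/
structure IsUnitNormal (r N : S → E3) : Prop where
  smooth : ContMDiff (𝓡 2) 𝓘(ℝ, E3) ∞ N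
  norm_eq_one : ∀ p : S, ‖N p‖ = 1
  orthogonal : ∀ (p : S) (w : TangentSpace (𝓡 2) p),
    inner ℝ (N p) (mfderiv (𝓡 2) 𝓘(ℝ, E3) r p w : E3) = 0

/-- For some choice of the unit normal, the angle between the unit normal and the position vector
is equal to `θ` at every point. -/
def HasSlope (r : S → E3) (θ : ℝ) : Prop :=
  ∃ N : S → E3, IsUnitNormal r N ∧ ∀ p : S, InnerProductGeometry.angle (N p) (r p) = θ

/-- Surfaces of constant slope. -/
def IsConstantSlope (r : S → E3) : Prop := ∃ θ ∈ Ico (0 : ℝ) Real.pi, HasSlope r θ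

/-- `φ` is a smooth coordinate chart `(u, v)` of `S` around `p`, with `u > 0` and `v ∈ J`, in which
the immersion `r` reads `X u v`. -/
structure IsParametrization (r : S → E3) (p : S) (J : Set ℝ) (X : ℝ → ℝ → E3)
    (φ : OpenPartialHomeomorph S E2) : Prop where
  mem_maximalAtlas : φ ∈ IsManifold.maximalAtlas (𝓡 2) ∞ S
  mem_source : p ∈ φ.source
  pos : ∀ x ∈ φ.target, 0 < x 0
  mem_interval : ∀ x ∈ φ.target, x 1 ∈ J
  eq : ∀ x ∈ φ.target, r (φ.symm x) = X (x 0) (x 1)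

/-- Near `p` the surface is parametrized by `slopeMap θ f`, for a unit speed curve `f` on the
unit sphere. -/
def HasSlopeParam (θ : ℝ) (r : S → E3) (p : S) : Prop :=
  ∃ (J : Set ℝ) (f : ℝ → E3) (φ : OpenPartialHomeomorph S E2),
    IsUnitSpeedSphereCurve J f ∧ IsParametrization r p J (slopeMap θ f) φ

/-- Near `p` the surface is parametrized by `r(u,v) = u f(v)`, for a unit speed curve `f` on the
unit sphere, and this piece of it is either an open part of a plane through the origin or a
cone with vertex at the origin which lies in no such plane. -/
def IsConeOrPlaneAt (r : S → E3) (p : S) : Prop :=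
  ∃ (J : Set ℝ) (f : ℝ → E3) (φ : OpenPartialHomeomorph S E2),
    IsUnitSpeedSphereCurve J f ∧ IsParametrization r p J (fun u v => u • f v) φ ∧
    ((∃ W : Submodule ℝ E3, Module.finrank ℝ W = 2 ∧ IsOpenPart (r '' φ.source) (W : Set E3)) ∨
      ∀ W : Submodule ℝ E3, Module.finrank ℝ W = 2 → ¬ r '' φ.source ⊆ (W : Set E3))

end Surfaces

/-! ### The vector product -/

/-! Let `e` be the direction of the position vector and write `N = cos θ e - sin θ e'`, so that `e,
e'` are orthonormal. With `u = |r| / sin θ` and `ξ = cot θ log u`, turn this pair back by the angle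
`ξ` to get `f, n`; then `r = u sin θ (cos ξ f + sin ξ n)`. The angle `ξ` is chosen so that the `du`
part of `dr` is `sin θ e + cos θ e'`, which is orthogonal to `N`. What remains of `⟨N, dr⟩ = 0` is
exactly `⟨n, df⟩ = 0` (`IsSlopePatch.exists_frame`).

For such a frame both `df` and `dn` are multiples of `m = n × f`. The form `⟨m, df⟩` is closed,
hence locally some `dv`, and symmetry of second derivatives makes `dn` proportional to `df` where
`df ≠ 0`. Since `r` is an immersion, `(u, v)` are then coordinates; `df = dv ⊗ m` says that `f`
depends on `v` alone, has unit speed, and satisfies `f × f' = n`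
(`IsParallelFrame.exists_slope_coordinates`).

The one obstruction is a point where `df = 0`. A homothety by `c` turns the frame by the constant
angle `cot θ log c`, and replaces `df` by a combination of `df` and `dn`. The immersion excludes `df
= dn = 0`, so only one angle modulo `π` can fail. For `θ = π/2` one has `ξ = 0`, and the immersion
itself forces `df ≠ 0`.

Conversely, the `v`-derivative of the spiral is orthogonal to `e` and `e'`, so a unit normal lies in
their plane and is orthogonal to `sin θ e + cos θ e'`. Its angle with `r` is therefore `θ` or `π -
θ`, and connectedness makes the choice global (`hasSlope_of_inner_sq_eq`). Slope `0` means that `r`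
is normal to the surface, so `|r|` is constant. -/

theorem inner_eq_coord (x y : E3) : inner ℝ x y = x 0 * y 0 + x 1 * y 1 + x 2 * y 2 := by
  simp [PiLp.inner_apply, Fin.sum_univ_three, mul_comm]

theorem cross3_apply_zero (a b : E3) : cross3 a b 0 = a 1 * b 2 - a 2 * b 1 := by
  simp [cross3, cross_apply]

theorem cross3_apply_one (a b : E3) : cross3 a b 1 = a 2 * b 0 - a 0 * b 2 := by
  simp [cross3, cross_apply]

theorem cross3_apply_two (a b : E3) : cross3 a b 2 = a 0 * b 1 - a 1 * b 0 := by
  simp [cross3, cross_apply]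

theorem inner_self_cross3 (a b : E3) : inner ℝ a (cross3 a b) = 0 := by
  rw [inner_eq_coord, cross3_apply_zero, cross3_apply_one, cross3_apply_two]; ring

theorem inner_cross3_self (a b : E3) : inner ℝ b (cross3 a b) = 0 := by
  rw [inner_eq_coord, cross3_apply_zero, cross3_apply_one, cross3_apply_two]; ring

theorem inner_cross3_cross3 (a b : E3) :
    inner ℝ (cross3 a b) (cross3 a b) = inner ℝ a a * inner ℝ b b - inner ℝ a b ^ 2 := by
  simp only [inner_eq_coord, cross3_apply_zero, cross3_apply_one, cross3_apply_two]; ring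

theorem norm_cross3_of_orthonormal {a b : E3} (ha : ‖a‖ = 1) (hb : ‖b‖ = 1)
    (hab : inner ℝ a b = 0) : ‖cross3 a b‖ = 1 := by
  have h := inner_cross3_cross3 a b
  rw [hab, real_inner_self_eq_norm_sq, real_inner_self_eq_norm_sq, real_inner_self_eq_norm_sq,
    ha, hb] at h
  have h0 := norm_nonneg (cross3 a b)
  nlinarith

theorem cross3_cross3_self (a b : E3) :
    cross3 a (cross3 b a) = inner ℝ a a • b - inner ℝ a b • a := by
  rw [inner_eq_coord, inner_eq_coord]
  ext i
  fin_cases i <;>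
    simp [cross3_apply_zero, cross3_apply_one, cross3_apply_two] <;> ring

/-- Used with `a = f` and `b = n`: once `f' = n × f` is known, it recovers `n` as `f × f'`. -/
theorem cross3_cross3_of_orthonormal {a b : E3} (ha : ‖a‖ = 1) (hab : inner ℝ a b = 0) :
    cross3 a (cross3 b a) = b := by
  rw [cross3_cross3_self, hab, real_inner_self_eq_norm_sq, ha]; simp

theorem contDiffOn_cross3 {V : Type*} [NormedAddCommGroup V] [NormedSpace ℝ V] {k : ℕ∞ω}
    {s : Set V} {a b : V → E3} (ha : ContDiffOn ℝ k a s) (hb : ContDiffOn ℝ k b s) :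
    ContDiffOn ℝ k (fun x => cross3 (a x) (b x)) s := by
  rw [contDiffOn_euclidean] at ha hb ⊢
  intro i
  fin_cases i
  · simpa [cross3_apply_zero] using ((ha 1).mul (hb 2)).sub ((ha 2).mul (hb 1))
  · simpa [cross3_apply_one] using ((ha 2).mul (hb 0)).sub ((ha 0).mul (hb 2))
  · simpa [cross3_apply_two] using ((ha 0).mul (hb 1)).sub ((ha 1).mul (hb 0))

/-! ### Orthonormal triples -/

/-- Three orthonormal vectors of Euclidean 3-space form an orthonormal basis. -/
theorem exists_orthonormalBasis_of_triple {a b c : E3} (ha : ‖a‖ = 1) (hb : ‖b‖ = 1)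
    (hc : ‖c‖ = 1) (hab : inner ℝ a b = 0) (hac : inner ℝ a c = 0) (hbc : inner ℝ b c = 0) :
    ∃ B : OrthonormalBasis (Fin 3) ℝ E3, B 0 = a ∧ B 1 = b ∧ B 2 = c := by
  have ho : Orthonormal ℝ ![a, b, c] := by
    constructor
    · intro i; fin_cases i <;> simp [ha, hb, hc]
    · intro i j hij
      fin_cases i <;> fin_cases j <;>
        simp_all [real_inner_comm]
  have hcard : Fintype.card (Fin 3) = Module.finrank ℝ E3 := by simp
  have hsp := (basisOfOrthonormalOfCardEqFinrank ho hcard).span_eq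
  rw [coe_basisOfOrthonormalOfCardEqFinrank] at hsp
  refine ⟨OrthonormalBasis.mk ho hsp.ge, ?_, ?_, ?_⟩ <;> simp

theorem eq_sum_of_orthonormal_triple {a b c : E3} (ha : ‖a‖ = 1) (hb : ‖b‖ = 1)
    (hc : ‖c‖ = 1) (hab : inner ℝ a b = 0) (hac : inner ℝ a c = 0) (hbc : inner ℝ b c = 0)
    (x : E3) : x = inner ℝ a x • a + inner ℝ b x • b + inner ℝ c x • c := by
  obtain ⟨B, rfl, rfl, rfl⟩ := exists_orthonormalBasis_of_triple ha hb hc hab hac hbc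
  have h := B.sum_repr' x
  rw [Fin.sum_univ_three] at h
  exact h.symm

theorem norm_sq_of_orthonormal_triple {a b c : E3} (ha : ‖a‖ = 1) (hb : ‖b‖ = 1)
    (hc : ‖c‖ = 1) (hab : inner ℝ a b = 0) (hac : inner ℝ a c = 0) (hbc : inner ℝ b c = 0)
    (x : E3) : ‖x‖ ^ 2 = inner ℝ a x ^ 2 + inner ℝ b x ^ 2 + inner ℝ c x ^ 2 := by
  obtain ⟨B, rfl, rfl, rfl⟩ := exists_orthonormalBasis_of_triple ha hb hc hab hac hbc
  have h := B.sum_sq_norm_inner_right x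
  rw [Fin.sum_univ_three] at h
  simpa using h.symm

/-! ### The spiral formula and its derivative -/

/-- `(u sin θ) (cos ξ f + sin ξ n)`, where `ξ = cot θ log u`. -/
noncomputable def spiralVector (θ u : ℝ) (f n : E3) : E3 :=
  (u * Real.sin θ) •
    (Real.cos (Real.cot θ * Real.log u) • f + Real.sin (Real.cot θ * Real.log u) • n)

theorem slopeMap_eq_spiralVector (θ : ℝ) (f : ℝ → E3) (u v : ℝ) :
    slopeMap θ f u v = spiralVector θ u (f v) (cross3 (f v) (deriv f v)) := rfl

theorem sin_mul_cot {θ : ℝ} (h : Real.sin θ ≠ 0) : Real.sin θ * Real.cot θ = Real.cos θ := by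
  rw [Real.cot_eq_cos_div_sin]; field_simp

section Derivative

variable {V : Type*} [NormedAddCommGroup V] [NormedSpace ℝ V]

theorem inner_eq_zero_of_norm_eq {f : V → E3} {f' : V →L[ℝ] E3} {x : V} {c : ℝ}
    (hf : HasFDerivAt f f' x) (h : ∀ᶠ y in nhds x, ‖f y‖ = c) (w : V) :
    inner ℝ (f x) (f' w) = 0 := by
  have h1 := hf.norm_sq
  have h2 : HasFDerivAt (fun y => ‖f y‖ ^ 2) (0 : V →L[ℝ] ℝ) x :=
    (hasFDerivAt_const (c ^ 2) x).congr_of_eventuallyEq (h.mono fun y hy => by simp [hy])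
  have h3 := congrArg (fun L : V →L[ℝ] ℝ => L w) (h1.unique h2)
  simpa using h3

theorem inner_add_inner_eq_zero_of_inner_eq {f g : V → E3} {f' g' : V →L[ℝ] E3} {x : V} {c : ℝ}
    (hf : HasFDerivAt f f' x) (hg : HasFDerivAt g g' x)
    (h : ∀ᶠ y in nhds x, inner ℝ (f y) (g y) = c) (w : V) :
    inner ℝ (f x) (g' w) + inner ℝ (f' w) (g x) = 0 := by
  have h1 := hf.inner ℝ hg
  have h2 : HasFDerivAt (fun y => (inner ℝ (f y) (g y) : ℝ)) (0 : V →L[ℝ] ℝ) x :=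
    (hasFDerivAt_const c x).congr_of_eventuallyEq h
  have h3 := congrArg (fun L : V →L[ℝ] ℝ => L w) (h1.unique h2)
  simpa using h3

/-- The derivative of `ξ` is `cot θ du / u`, so differentiating the angle contributes `cos θ du`
times the rotated vector `e'`. No factor `u` survives in the `du` term; this is why `ξ` is
logarithmic. -/
theorem hasFDerivAt_spiralVector {θ : ℝ} (hθ : Real.sin θ ≠ 0) {u : V → ℝ} {f n : V → E3}
    {u' : V →L[ℝ] ℝ} {f' n' : V →L[ℝ] E3} {x : V} (hu : HasFDerivAt u u' x)
    (hf : HasFDerivAt f f' x) (hn : HasFDerivAt n n' x) (hux : u x ≠ 0) :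
    ∃ L : V →L[ℝ] E3, HasFDerivAt (fun y => spiralVector θ (u y) (f y) (n y)) L x ∧
      ∀ w, L w =
        u' w • (Real.sin θ • (Real.cos (Real.cot θ * Real.log (u x)) • f x +
            Real.sin (Real.cot θ * Real.log (u x)) • n x) +
          Real.cos θ • (-Real.sin (Real.cot θ * Real.log (u x)) • f x +
            Real.cos (Real.cot θ * Real.log (u x)) • n x)) +
        (u x * Real.sin θ) • (Real.cos (Real.cot θ * Real.log (u x)) • f' w +
            Real.sin (Real.cot θ * Real.log (u x)) • n' w) := by
  have hξ : HasFDerivAt (fun y => Real.cot θ * Real.log (u y)) _ x :=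
    (hu.log hux).const_mul (Real.cot θ)
  have hA := (hξ.cos.smul hf).add (hξ.sin.smul hn)
  have hB := (hu.mul_const (Real.sin θ)).smul hA
  refine ⟨_, hB, fun w => ?_⟩
  have h1 : u x * Real.sin θ * (Real.cot θ * ((u x)⁻¹ * u' w)) = Real.cos θ * u' w := by
    rw [← sin_mul_cot hθ]; field_simp
  set ξ := Real.cot θ * Real.log (u x)
  simp only [add_apply, smul_apply,
    ContinuousLinearMap.smulRight_apply, smul_eq_mul, smul_add, smul_smul, neg_smul, neg_mul,
    Pi.add_apply, Pi.smul_apply']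
  linear_combination (norm := module) (-Real.sin ξ * h1) • f x + (Real.cos ξ * h1) • n x

end Derivative

/-! ### Smooth local coordinates from the inverse function theorem -/

/-- A smooth map of `E` to itself whose derivative at `p` is injective restricts to a
diffeomorphism of a neighbourhood of `p` onto a ball. -/
theorem exists_diffeo_onto_ball {E : Type*} [NormedAddCommGroup E] [NormedSpace ℝ E]
    [FiniteDimensional ℝ E] {Ψ : E → E} {O : Set E} (hO : IsOpen O) (hΨ : ContDiffOn ℝ ∞ Ψ O)
    {p : E} (hp : p ∈ O) (hinj : Function.Injective (fderiv ℝ Ψ p)) :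
    ∃ (ψ : OpenPartialHomeomorph E E) (ε : ℝ), 0 < ε ∧ ⇑ψ = Ψ ∧ p ∈ ψ.source ∧ ψ.source ⊆ O ∧
      ψ.target = Metric.ball (Ψ p) ε ∧ ContDiffOn ℝ ∞ ψ ψ.source ∧
      ContDiffOn ℝ ∞ ψ.symm ψ.target := by
  have : CompleteSpace E := FiniteDimensional.complete ℝ E
  have hd : ∀ x ∈ O, HasFDerivAt Ψ (fderiv ℝ Ψ x) x := fun x hx =>
    ((hΨ.contDiffAt (hO.mem_nhds hx)).differentiableAt (by simp)).hasFDerivAt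
  let A : E ≃L[ℝ] E :=
    (LinearEquiv.ofInjectiveEndo (fderiv ℝ Ψ p : E →ₗ[ℝ] E) hinj).toContinuousLinearEquiv
  have hA : (A : E →L[ℝ] E) = fderiv ℝ Ψ p := by ext w; rfl
  have hcd : ContDiffAt ℝ ∞ Ψ p := hΨ.contDiffAt (hO.mem_nhds hp)
  have hAp : HasFDerivAt Ψ (A : E →L[ℝ] E) p := hA ▸ hd p hp
  let h₀ := hcd.toOpenPartialHomeomorph Ψ hAp (by simp)
  -- Invertibility of the derivative is an open condition. It is needed at every point of the
  -- domain, so that the inverse is smooth on the whole target and not only at `Ψ p`.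
  have hcont : ContinuousAt (fderiv ℝ Ψ) p :=
    (hΨ.continuousOn_fderiv_of_isOpen hO (by simp)).continuousAt (hO.mem_nhds hp)
  have hev : ∀ᶠ x in nhds p, x ∈ O ∧ fderiv ℝ Ψ x ∈ range ((↑) : (E ≃L[ℝ] E) → E →L[ℝ] E) :=
    Filter.Eventually.and (hO.mem_nhds hp) (hcont.eventually (hA ▸ A.nhds))
  obtain ⟨O', hO'sub, hO', hpO'⟩ := eventually_nhds_iff.1 hev
  let h₁ := h₀.restrOpen O' hO'
  have hp₁ : p ∈ h₁.source := ⟨hcd.mem_toOpenPartialHomeomorph_source hAp (by simp), hpO'⟩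
  have hpt : Ψ p ∈ h₁.target := h₁.map_source hp₁
  obtain ⟨ε, hε, hball⟩ := Metric.isOpen_iff.1 h₁.open_target _ hpt
  -- The restriction is made on the target side, so that the image is exactly a ball; its convexity
  -- is used later.
  let ψ := (h₁.symm.restrOpen (Metric.ball (Ψ p) ε) Metric.isOpen_ball).symm
  have hcoe : ⇑ψ = Ψ := rfl
  have hsrc : ψ.source ⊆ O' := by
    intro x hx
    have : x ∈ h₁.source := by
      have h2 := ψ.map_source hx
      have h3 : ψ x ∈ h₁.target := h2.1
      have h4 := ψ.left_inv hx
      rw [← h4]; exact h₁.map_target h3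
    exact this.2
  have htar : ψ.target = Metric.ball (Ψ p) ε := by
    change h₁.target ∩ Metric.ball (Ψ p) ε = _
    exact inter_eq_right.2 hball
  have hpsrc : p ∈ ψ.source := by
    have h1 : Ψ p ∈ ψ.target := by rw [htar]; exact Metric.mem_ball_self hε
    have h2 := ψ.map_target h1
    have h3 : ψ.symm (Ψ p) = p := h₁.left_inv hp₁
    rwa [h3] at h2
  refine ⟨ψ, ε, hε, hcoe, hpsrc, fun x hx => (hO'sub x (hsrc hx)).1, htar, ?_, ?_⟩
  · rw [hcoe]; exact hΨ.mono fun x hx => (hO'sub x (hsrc hx)).1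
  · intro y hy
    obtain ⟨hyO, B, hB⟩ := hO'sub _ (hsrc (ψ.map_target hy))
    refine (ψ.contDiffAt_symm hy (f₀' := B) ?_ ?_).contDiffWithinAt
    · rw [hB]; exact hd _ hyO
    · exact hΨ.contDiffAt (hO.mem_nhds hyO)

/-! ### Frames with one-dimensional variation -/

/-- Along the open set `U` of the plane, `f` and `n` are smooth orthonormal fields, and the
derivative of `f` has no component along `n`. -/
structure IsParallelFrame (U : Set E2) (f n : E2 → E3) : Prop where
  isOpen : IsOpen U
  smooth_fst : ContDiffOn ℝ ∞ f U
  smooth_snd : ContDiffOn ℝ ∞ n U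
  norm_fst : ∀ x ∈ U, ‖f x‖ = 1
  norm_snd : ∀ x ∈ U, ‖n x‖ = 1
  inner_eq_zero : ∀ x ∈ U, inner ℝ (f x) (n x) = 0
  inner_fderiv : ∀ x ∈ U, ∀ w, inner ℝ (fderiv ℝ f x w) (n x) = 0

namespace IsParallelFrame

variable {U : Set E2} {f n : E2 → E3}

theorem hasFDerivAt_fst (h : IsParallelFrame U f n) {x : E2} (hx : x ∈ U) :
    HasFDerivAt f (fderiv ℝ f x) x :=
  ((h.smooth_fst.contDiffAt (h.isOpen.mem_nhds hx)).differentiableAt (by simp)).hasFDerivAt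

theorem hasFDerivAt_snd (h : IsParallelFrame U f n) {x : E2} (hx : x ∈ U) :
    HasFDerivAt n (fderiv ℝ n x) x :=
  ((h.smooth_snd.contDiffAt (h.isOpen.mem_nhds hx)).differentiableAt (by simp)).hasFDerivAt

theorem eventually_mem (h : IsParallelFrame U f n) {x : E2} (hx : x ∈ U) :
    ∀ᶠ y in nhds x, y ∈ U := h.isOpen.mem_nhds hx

theorem smooth_fderiv (h : IsParallelFrame U f n) : ContDiffOn ℝ ∞ (fderiv ℝ f) U :=
  h.smooth_fst.fderiv_of_isOpen h.isOpen (by simp)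

theorem inner_fst_fderiv (h : IsParallelFrame U f n) {x : E2} (hx : x ∈ U) (w : E2) :
    inner ℝ (f x) (fderiv ℝ f x w) = 0 :=
  inner_eq_zero_of_norm_eq (h.hasFDerivAt_fst hx)
    ((h.eventually_mem hx).mono fun y hy => h.norm_fst y hy) w

theorem inner_snd_fderiv_snd (h : IsParallelFrame U f n) {x : E2} (hx : x ∈ U) (w : E2) :
    inner ℝ (n x) (fderiv ℝ n x w) = 0 :=
  inner_eq_zero_of_norm_eq (h.hasFDerivAt_snd hx)
    ((h.eventually_mem hx).mono fun y hy => h.norm_snd y hy) w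

theorem inner_fst_fderiv_snd (h : IsParallelFrame U f n) {x : E2} (hx : x ∈ U) (w : E2) :
    inner ℝ (f x) (fderiv ℝ n x w) = 0 := by
  have h1 := inner_add_inner_eq_zero_of_inner_eq (h.hasFDerivAt_fst hx) (h.hasFDerivAt_snd hx)
    ((h.eventually_mem hx).mono fun y hy => h.inner_eq_zero y hy) w
  rw [h.inner_fderiv x hx w] at h1
  simpa using h1

theorem norm_cross (h : IsParallelFrame U f n) {x : E2} (hx : x ∈ U) :
    ‖cross3 (n x) (f x)‖ = 1 :=
  norm_cross3_of_orthonormal (h.norm_snd x hx) (h.norm_fst x hx)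
    (by rw [real_inner_comm]; exact h.inner_eq_zero x hx)

theorem eq_smul_cross (h : IsParallelFrame U f n) {x : E2} (hx : x ∈ U) {y : E3}
    (h1 : inner ℝ (f x) y = 0) (h2 : inner ℝ (n x) y = 0) :
    y = inner ℝ (cross3 (n x) (f x)) y • cross3 (n x) (f x) := by
  have := eq_sum_of_orthonormal_triple (h.norm_fst x hx) (h.norm_snd x hx) (h.norm_cross hx)
    (h.inner_eq_zero x hx) (inner_cross3_self _ _) (inner_self_cross3 _ _) y
  rw [h1, h2] at this
  simpa using this

/-- The `1`-form `⟨n × f, df⟩`. -/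
noncomputable def form (f n : E2 → E3) (x : E2) : E2 →L[ℝ] ℝ :=
  (innerSL ℝ (cross3 (n x) (f x))).comp (fderiv ℝ f x)

theorem fderiv_apply (h : IsParallelFrame U f n) {x : E2} (hx : x ∈ U) (w : E2) :
    fderiv ℝ f x w = form f n x w • cross3 (n x) (f x) :=
  h.eq_smul_cross hx (h.inner_fst_fderiv hx w)
    (by rw [real_inner_comm]; exact h.inner_fderiv x hx w)

theorem smooth_cross (h : IsParallelFrame U f n) :
    ContDiffOn ℝ ∞ (fun x => cross3 (n x) (f x)) U :=
  contDiffOn_cross3 h.smooth_snd h.smooth_fst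

theorem smooth_form (h : IsParallelFrame U f n) : ContDiffOn ℝ ∞ (form f n) U :=
  ((innerSL ℝ).contDiff.comp_contDiffOn h.smooth_cross).clm_comp h.smooth_fderiv

theorem fderiv_fderiv_comm (h : IsParallelFrame U f n) {x : E2} (hx : x ∈ U) (a b : E2) :
    fderiv ℝ (fderiv ℝ f) x a b = fderiv ℝ (fderiv ℝ f) x b a :=
  ((h.smooth_fst.contDiffAt (h.isOpen.mem_nhds hx)).isSymmSndFDerivAt
    (by simp only [minSmoothness_of_isRCLikeNormedField]; exact WithTop.coe_le_coe.2 le_top)) a b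

theorem hasFDerivAt_fderiv_apply (h : IsParallelFrame U f n) {x : E2} (hx : x ∈ U) (b : E2) :
    HasFDerivAt (fun y => fderiv ℝ f y b) ((fderiv ℝ (fderiv ℝ f) x).flip b) x := by
  have h1 : HasFDerivAt (fderiv ℝ f) (fderiv ℝ (fderiv ℝ f) x) x :=
    ((h.smooth_fderiv.contDiffAt (h.isOpen.mem_nhds hx)).differentiableAt (by simp)).hasFDerivAt
  simpa using h1.clm_apply (hasFDerivAt_const b x)

/-- Put `m = n × f`. As `m` is a unit field, `dm` is orthogonal to `m`, while `df` is a multiple of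
`m`. Hence the term `⟨dm a, df b⟩` vanishes, and only `⟨m, D²f (a, b)⟩` is left, which is symmetric.
-/
theorem form_closed (h : IsParallelFrame U f n) {x : E2} (hx : x ∈ U) (a b : E2) :
    fderiv ℝ (form f n) x a b = fderiv ℝ (form f n) x b a := by
  have hm : HasFDerivAt (fun y => cross3 (n y) (f y)) _ x :=
    ((h.smooth_cross.contDiffAt (h.isOpen.mem_nhds hx)).differentiableAt (by simp)).hasFDerivAt
  have hform : HasFDerivAt (form f n) (fderiv ℝ (form f n) x) x :=
    ((h.smooth_form.contDiffAt (h.isOpen.mem_nhds hx)).differentiableAt (by simp)).hasFDerivAt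
  have key : ∀ a b, fderiv ℝ (form f n) x a b =
      inner ℝ (cross3 (n x) (f x)) (fderiv ℝ (fderiv ℝ f) x a b) := by
    intro a b
    have h1 : HasFDerivAt (fun y => form f n y b) ((fderiv ℝ (form f n) x).flip b) x := by
      simpa using hform.clm_apply (hasFDerivAt_const b x)
    have h2 := hm.inner ℝ (h.hasFDerivAt_fderiv_apply hx b)
    have h3 := congrArg (fun L : E2 →L[ℝ] ℝ => L a) (h1.unique h2)
    have h4 := inner_eq_zero_of_norm_eq hm
      ((h.eventually_mem hx).mono fun y hy => h.norm_cross hy) a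
    have h5 : inner ℝ (fderiv ℝ (fun y => cross3 (n y) (f y)) x a) (fderiv ℝ f x b) = 0 := by
      rw [h.fderiv_apply hx b, inner_smul_right, real_inner_comm, h4, mul_zero]
    simpa [h5] using h3
  rw [key, key, h.fderiv_fderiv_comm hx]

/-- The Poincaré lemma on a ball; the primitive is smooth because its derivative is. -/
theorem exists_primitive (h : IsParallelFrame U f n) {p : E2} {ε : ℝ}
    (hb : Metric.ball p ε ⊆ U) :
    ∃ v : E2 → ℝ, (∀ x ∈ Metric.ball p ε, HasFDerivAt v (form f n x) x) ∧
      ContDiffOn ℝ ∞ v (Metric.ball p ε) := by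
  obtain ⟨v, hv⟩ := (convex_ball p ε).exists_forall_hasFDerivAt_of_fderiv_symmetric
    Metric.isOpen_ball
    ((h.smooth_form.differentiableOn (by simp)).mono hb)
    (fun x hx a b => h.form_closed (hb hx) a b)
  refine ⟨v, hv, ?_⟩
  rw [contDiffOn_infty_iff_fderiv_of_isOpen Metric.isOpen_ball]
  refine ⟨fun x hx => (hv x hx).differentiableAt.differentiableWithinAt, ?_⟩
  exact (h.smooth_form.mono hb).congr fun x hx => (hv x hx).fderiv

/-- Differentiating `⟨df a, n⟩ = 0` along `b` expresses the left side through the symmetric second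
derivative of `f`. -/
theorem inner_fderiv_fderiv_comm (h : IsParallelFrame U f n) {x : E2} (hx : x ∈ U) (a b : E2) :
    inner ℝ (fderiv ℝ f x a) (fderiv ℝ n x b) = inner ℝ (fderiv ℝ f x b) (fderiv ℝ n x a) := by
  have key : ∀ a b, inner ℝ (fderiv ℝ f x a) (fderiv ℝ n x b) =
      - inner ℝ (fderiv ℝ (fderiv ℝ f) x b a) (n x) := by
    intro a b
    have h1 := inner_add_inner_eq_zero_of_inner_eq (h.hasFDerivAt_fderiv_apply hx a)
      (h.hasFDerivAt_snd hx) ((h.eventually_mem hx).mono fun y hy => h.inner_fderiv y hy a) b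
    simp only [ContinuousLinearMap.flip_apply] at h1
    linarith
  rw [key, key, h.fderiv_fderiv_comm hx]

/-- Where `df ≠ 0`, a direction killed by `df` is also killed by `dn`. -/
theorem fderiv_snd_eq_zero (h : IsParallelFrame U f n) {x : E2} (hx : x ∈ U)
    (hne : fderiv ℝ f x ≠ 0) {w : E2} (hw : fderiv ℝ f x w = 0) : fderiv ℝ n x w = 0 := by
  obtain ⟨a, ha⟩ : ∃ a, fderiv ℝ f x a ≠ 0 := by
    by_contra! H
    exact hne (ContinuousLinearMap.ext H)
  have hform : form f n x a ≠ 0 := fun h0 => ha (by rw [h.fderiv_apply hx, h0, zero_smul])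
  -- `df a` is a nonzero multiple of `n × f`, so the symmetry leaves `dn w` without a component
  -- along `n × f`, the only component it can have.
  have h1 := h.inner_fderiv_fderiv_comm hx a w
  rw [hw, inner_zero_left, h.fderiv_apply hx a, inner_smul_left] at h1
  have h2 : inner ℝ (cross3 (n x) (f x)) (fderiv ℝ n x w) = 0 := by
    simpa [hform] using h1
  have h3 := h.eq_smul_cross hx (h.inner_fst_fderiv_snd hx w) (h.inner_snd_fderiv_snd hx w)
  rw [h3, h2, zero_smul]

end IsParallelFrame

/-- Near `p`, and inside `U`, there are smooth coordinates in which `F` is `slopeMap θ g`. -/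
def HasSlopeCoordinates (θ : ℝ) (U : Set E2) (F : E2 → E3) (p : E2) : Prop :=
  ∃ (J : Set ℝ) (g : ℝ → E3) (ψ : OpenPartialHomeomorph E2 E2),
    IsUnitSpeedSphereCurve J g ∧ p ∈ ψ.source ∧ ψ.source ⊆ U ∧
    ContDiffOn ℝ ∞ ψ ψ.source ∧ ContDiffOn ℝ ∞ ψ.symm ψ.target ∧
    ∀ y ∈ ψ.target, 0 < y 0 ∧ y 1 ∈ J ∧ F (ψ.symm y) = slopeMap θ g (y 0) (y 1)

/-- A map of the plane which near `p` is written by a parallel frame as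
`spiralVector θ (u x) (f x) (n x)`, with `df ≠ 0` at `p`, is parametrized near `p` by
`slopeMap θ g` for a unit speed curve `g` on the sphere. -/
theorem IsParallelFrame.exists_slope_coordinates {U : Set E2} {f n : E2 → E3}
    (h : IsParallelFrame U f n) {θ : ℝ} (hθ : Real.sin θ ≠ 0) {u : E2 → ℝ} {F : E2 → E3}
    (hu : ContDiffOn ℝ ∞ u U) (hpos : ∀ x ∈ U, 0 < u x)
    (hF : ∀ x ∈ U, F x = spiralVector θ (u x) (f x) (n x)) {p : E2} (hp : p ∈ U)
    (himm : Function.Injective (fderiv ℝ F p)) (hne : fderiv ℝ f p ≠ 0) :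
    HasSlopeCoordinates θ U F p := by
  have hud : ∀ x ∈ U, HasFDerivAt u (fderiv ℝ u x) x := fun x hx =>
    ((hu.contDiffAt (h.isOpen.mem_nhds hx)).differentiableAt (by simp)).hasFDerivAt
  obtain ⟨δ, hδ, hball⟩ := Metric.isOpen_iff.1 h.isOpen p hp
  obtain ⟨v, hv, hvs⟩ := h.exists_primitive hball
  have hpb : p ∈ Metric.ball p δ := Metric.mem_ball_self hδ
  let Ψ : E2 → E2 := fun x => !₂[u x, v x]
  have hΨs : ContDiffOn ℝ ∞ Ψ (Metric.ball p δ) := by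
    rw [contDiffOn_euclidean]
    intro i
    fin_cases i
    · exact hu.mono hball
    · exact hvs
  have hΨd : ∀ x ∈ Metric.ball p δ, HasFDerivAt Ψ (fderiv ℝ Ψ x) x := fun x hx =>
    ((hΨs.contDiffAt (Metric.isOpen_ball.mem_nhds hx)).differentiableAt (by simp)).hasFDerivAt
  have hΨ0 : ∀ x ∈ Metric.ball p δ, ∀ w, fderiv ℝ Ψ x w 0 = fderiv ℝ u x w := fun x hx w => by
    have h1 := ((EuclideanSpace.proj (0 : Fin 2) : E2 →L[ℝ] ℝ).hasFDerivAt).comp x (hΨd x hx)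
    exact congrArg (fun L : E2 →L[ℝ] ℝ => L w) (h1.unique (hud x (hball hx)))
  have hΨ1 : ∀ x ∈ Metric.ball p δ, ∀ w, fderiv ℝ Ψ x w 1 = form f n x w := fun x hx w => by
    have h1 := ((EuclideanSpace.proj (1 : Fin 2) : E2 →L[ℝ] ℝ).hasFDerivAt).comp x (hΨd x hx)
    exact congrArg (fun L : E2 →L[ℝ] ℝ => L w) (h1.unique (hv x hx))
  have hinj : Function.Injective (fderiv ℝ Ψ p) := by
    rw [injective_iff_map_eq_zero]
    intro w hw
    -- A vector killed by `du` and `dv` is killed by `df`, then by `dn` because `df ≠ 0` at `p`, and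
    -- so by `dF`.
    have h0 : fderiv ℝ u p w = 0 := by rw [← hΨ0 p hpb w, hw]; rfl
    have h1 : form f n p w = 0 := by rw [← hΨ1 p hpb w, hw]; rfl
    have h2 : fderiv ℝ f p w = 0 := by rw [h.fderiv_apply hp, h1, zero_smul]
    have h3 : fderiv ℝ n p w = 0 := h.fderiv_snd_eq_zero hp hne h2
    obtain ⟨L, hL, hLw⟩ := hasFDerivAt_spiralVector hθ (hud p hp) (h.hasFDerivAt_fst hp)
      (h.hasFDerivAt_snd hp) (hpos p hp).ne'
    have h4 : fderiv ℝ F p = L :=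
      (hL.congr_of_eventuallyEq ((h.eventually_mem hp).mono hF)).fderiv
    apply himm
    rw [map_zero, h4, hLw, h0, h2, h3]
    simp
  obtain ⟨ψ, ε, hε, hcoe, hpψ, hsrc, htar, hψ, hψs⟩ :=
    exists_diffeo_onto_ball Metric.isOpen_ball hΨs hpb hinj
  have hsU : ∀ y ∈ ψ.target, ψ.symm y ∈ U := fun y hy => hball (hsrc (ψ.map_target hy))
  have hval : ∀ y ∈ ψ.target, u (ψ.symm y) = y 0 ∧ v (ψ.symm y) = y 1 := by
    intro y hy
    have h1 : Ψ (ψ.symm y) = y := by rw [← hcoe]; exact ψ.right_inv hy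
    exact ⟨congrArg (fun z : E2 => z 0) h1, congrArg (fun z : E2 => z 1) h1⟩
  have hsd : ∀ y ∈ ψ.target, HasFDerivAt ψ.symm (fderiv ℝ ψ.symm y) y := fun y hy =>
    ((hψs.contDiffAt (ψ.open_target.mem_nhds hy)).differentiableAt (by simp)).hasFDerivAt
  have hev : ∀ y ∈ ψ.target, ∀ᶠ z in nhds y, z ∈ ψ.target := fun y hy =>
    ψ.open_target.mem_nhds hy
  -- in the new coordinates the derivative of `f` is `dv ⊗ (n × f)`
  have hfd : ∀ y ∈ ψ.target, ∃ L : E2 →L[ℝ] E3, HasFDerivAt (f ∘ ψ.symm) L y ∧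
      ∀ w, L w = w 1 • cross3 (n (ψ.symm y)) (f (ψ.symm y)) := by
    intro y hy
    refine ⟨_, (h.hasFDerivAt_fst (hsU y hy)).comp y (hsd y hy), fun w => ?_⟩
    have h1 := (hv _ (hsrc (ψ.map_target hy))).comp y (hsd y hy)
    have h2 : HasFDerivAt (v ∘ ψ.symm) (EuclideanSpace.proj (1 : Fin 2) : E2 →L[ℝ] ℝ) y :=
      (EuclideanSpace.proj (1 : Fin 2) : E2 →L[ℝ] ℝ).hasFDerivAt.congr_of_eventuallyEq
        ((hev y hy).mono
          fun z hz => (hval z hz).2)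
    have h3 : form f n (ψ.symm y) (fderiv ℝ ψ.symm y w) = w 1 :=
      congrArg (fun L : E2 →L[ℝ] ℝ => L w) (h1.unique h2)
    rw [ContinuousLinearMap.comp_apply, h.fderiv_apply (hsU y hy), h3]
  set q := Ψ p with hq
  -- The diameter of the target ball along which `u` is constant. Every point of the ball projects
  -- onto it with the same second coordinate, so it carries the curve `g`.
  let line : ℝ → E2 := fun t => !₂[q 0, t]
  have hline : ∀ y ∈ ψ.target, line (y 1) ∈ ψ.target := by
    intro y hy
    rw [htar, mem_ball_iff_norm, EuclideanSpace.norm_eq, Fin.sum_univ_two] at hy ⊢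
    refine lt_of_le_of_lt (Real.sqrt_le_sqrt ?_) hy
    simp only [line, PiLp.sub_apply]
    simpa using sq_nonneg (y 0 - q 0)
  let J : Set ℝ := Ioo (q 1 - ε) (q 1 + ε)
  have hmemJ : ∀ t, t ∈ J ↔ line t ∈ ψ.target := by
    intro t
    rw [htar, mem_ball_iff_norm, EuclideanSpace.norm_eq, Fin.sum_univ_two]
    simp only [line, PiLp.sub_apply, J, mem_Ioo]
    simp [Real.sqrt_sq_eq_abs, abs_lt]
    constructor <;> rintro ⟨h1, h2⟩ <;> constructor <;> linarith
  let g : ℝ → E3 := fun t => f (ψ.symm (line t))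
  have hlines : ContDiff ℝ ∞ line := by
    rw [contDiff_euclidean]
    intro i
    fin_cases i
    · exact contDiff_const
    · exact contDiff_id
  have hlined : ∀ t, HasDerivAt line !₂[0, 1] t := by
    intro t
    have h1 : line = fun t => !₂[q 0, 0] + t • !₂[(0 : ℝ), 1] := by
      funext t; ext i; fin_cases i <;> simp [line]
    rw [h1]
    simpa using ((hasDerivAt_id t).smul_const !₂[(0 : ℝ), 1]).const_add !₂[q 0, 0]
  have hgd : ∀ t ∈ J, HasDerivAt g
      (cross3 (n (ψ.symm (line t))) (f (ψ.symm (line t)))) t := by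
    intro t ht
    obtain ⟨L, hL, hLw⟩ := hfd _ ((hmemJ t).1 ht)
    have := hL.comp_hasDerivAt t (hlined t)
    rw [hLw] at this
    have h1 : (!₂[(0 : ℝ), 1] : E2) 1 = 1 := rfl
    rw [h1, one_smul] at this
    exact this
  -- `f` depends on the second coordinate only
  have hconst : ∀ y ∈ ψ.target, f (ψ.symm y) = g (y 1) := by
    intro y hy
    have hseg : ∀ t ∈ Icc (0 : ℝ) 1, line (y 1) + t • (y - line (y 1)) ∈ ψ.target := by
      intro t ht
      have hc : Convex ℝ ψ.target := by rw [htar]; exact convex_ball _ _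
      exact hc.add_smul_sub_mem (hline y hy) hy ht
    have hd : ∀ t ∈ Icc (0 : ℝ) 1,
        HasDerivAt (fun t : ℝ => (f ∘ ψ.symm) (line (y 1) + t • (y - line (y 1)))) 0 t := by
      intro t ht
      obtain ⟨L, hL, hLw⟩ := hfd _ (hseg t ht)
      have h1 : HasDerivAt (fun t : ℝ => line (y 1) + t • (y - line (y 1)))
          (y - line (y 1)) t := by
        simpa using ((hasDerivAt_id t).smul_const (y - line (y 1))).const_add (line (y 1))
      have h2 := hL.comp_hasDerivAt t h1
      have h3 : (y - line (y 1)) 1 = 0 := by simp [line]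
      rw [hLw, h3, zero_smul] at h2
      exact h2
    have h3 := constant_of_has_deriv_right_zero
      (fun t ht => (hd t ht).continuousAt.continuousWithinAt)
      (fun t ht => (hd t (Ico_subset_Icc_self ht)).hasDerivWithinAt) 1 (by simp)
    simpa using h3
  -- `hgd` gives this only on the diameter. At a general `y`, the map `f ∘ ψ.symm` equals `g` of the
  -- second coordinate nearby, and the two derivatives are compared; so `n × f` also depends on `v`
  -- alone.
  have hderiv : ∀ y ∈ ψ.target, deriv g (y 1) = cross3 (n (ψ.symm y)) (f (ψ.symm y)) := by
    intro y hy
    obtain ⟨L, hL, hLw⟩ := hfd y hy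
    have hyJ : y 1 ∈ J := (hmemJ _).2 (hline y hy)
    have h1 := HasFDerivAt.comp (g := g) (f := (EuclideanSpace.proj (1 : Fin 2) : E2 →L[ℝ] ℝ)) y
      (hgd _ hyJ).hasFDerivAt (EuclideanSpace.proj (1 : Fin 2) : E2 →L[ℝ] ℝ).hasFDerivAt
    have h2 := hL.congr_of_eventuallyEq
      ((hev y hy).mono
          fun z hz => (hconst z hz).symm)
    have h3 := congrArg (fun L : E2 →L[ℝ] E3 => L !₂[0, 1]) (h2.unique h1)
    simp only [hLw] at h3
    rw [(hgd _ hyJ).deriv]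
    simpa using h3.symm
  refine ⟨J, g, ψ, ⟨isOpen_Ioo, ordConnected_Ioo, ?_, ?_, ?_⟩, hpψ,
    fun x hx => hball (hsrc hx), hψ, hψs, fun y hy => ⟨?_, (hmemJ _).2 (hline y hy), ?_⟩⟩
  · have h1 : ContDiffOn ℝ ∞ (f ∘ ψ.symm) ψ.target := h.smooth_fst.comp hψs hsU
    exact h1.comp hlines.contDiffOn fun t ht => (hmemJ t).1 ht
  · exact fun t ht => h.norm_fst _ (hsU _ ((hmemJ t).1 ht))
  · intro t ht
    rw [(hgd t ht).deriv]
    exact h.norm_cross (hsU _ ((hmemJ t).1 ht))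
  · rw [← (hval y hy).1]; exact hpos _ (hsU y hy)
  · rw [hF _ (hsU y hy), slopeMap_eq_spiralVector, hderiv y hy, ← hconst y hy, (hval y hy).1,
      cross3_cross3_of_orthonormal (h.norm_fst _ (hsU y hy)) (h.inner_eq_zero _ (hsU y hy))]

/-! ### Rotation of a parallel frame by a constant angle -/

/-- All products of `f` and `n` with `df` and `dn` vanish, a property that constant combinations
inherit. -/
theorem IsParallelFrame.rotate {U : Set E2} {f n : E2 → E3} (h : IsParallelFrame U f n) (δ : ℝ) :
    IsParallelFrame U (fun x => Real.cos δ • f x - Real.sin δ • n x)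
      (fun x => Real.sin δ • f x + Real.cos δ • n x) := by
  have key : ∀ x ∈ U, inner ℝ (f x) (f x) = 1 ∧ inner ℝ (n x) (n x) = 1 ∧
      inner ℝ (f x) (n x) = 0 ∧ inner ℝ (n x) (f x) = 0 := fun x hx => by
    refine ⟨?_, ?_, h.inner_eq_zero x hx, ?_⟩
    · rw [real_inner_self_eq_norm_sq, h.norm_fst x hx]; norm_num
    · rw [real_inner_self_eq_norm_sq, h.norm_snd x hx]; norm_num
    · rw [real_inner_comm]; exact h.inner_eq_zero x hx
  have hsc := Real.sin_sq_add_cos_sq δ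
  constructor
  · exact h.isOpen
  · exact (h.smooth_fst.const_smul _).sub (h.smooth_snd.const_smul _)
  · exact (h.smooth_fst.const_smul _).add (h.smooth_snd.const_smul _)
  · intro x hx
    obtain ⟨h1, h2, h3, h4⟩ := key x hx
    rw [← sq_eq_sq₀ (norm_nonneg _) zero_le_one, ← real_inner_self_eq_norm_sq]
    simp only [inner_sub_left, inner_sub_right, real_inner_smul_left, real_inner_smul_right,
      h1, h2, h3, h4]
    linarith
  · intro x hx
    obtain ⟨h1, h2, h3, h4⟩ := key x hx
    rw [← sq_eq_sq₀ (norm_nonneg _) zero_le_one, ← real_inner_self_eq_norm_sq]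
    simp only [inner_add_left, inner_add_right, real_inner_smul_left, real_inner_smul_right,
      h1, h2, h3, h4]
    linarith
  · intro x hx
    obtain ⟨h1, h2, h3, h4⟩ := key x hx
    simp only [inner_sub_left, inner_add_right, real_inner_smul_left, real_inner_smul_right,
      h1, h2, h3, h4]
    ring
  · intro x hx w
    have hd : HasFDerivAt (fun x => Real.cos δ • f x - Real.sin δ • n x) _ x :=
      ((h.hasFDerivAt_fst hx).const_smul (Real.cos δ)).sub
        ((h.hasFDerivAt_snd hx).const_smul (Real.sin δ))
    have h1 := h.inner_fst_fderiv hx w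
    have h2 := h.inner_snd_fderiv_snd hx w
    have h3 := h.inner_fst_fderiv_snd hx w
    have h4 := h.inner_fderiv x hx w
    rw [real_inner_comm] at h1 h2 h3
    rw [hd.fderiv]
    simp only [sub_apply, smul_apply, inner_sub_left,
      inner_add_right, real_inner_smul_left, real_inner_smul_right, h1, h2, h3, h4]
    ring

/-- Scaling `u` by `c` adds `cot θ log c` to `ξ`; turning the frame by the same angle the other way
compensates. A homothety thus changes the frame, and with it the curve. -/
theorem spiralVector_rotate {θ c u : ℝ} (hc : 0 < c) (hu : 0 < u) (f n : E3) :
    spiralVector θ (c * u)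
      (Real.cos (Real.cot θ * Real.log c) • f - Real.sin (Real.cot θ * Real.log c) • n)
      (Real.sin (Real.cot θ * Real.log c) • f + Real.cos (Real.cot θ * Real.log c) • n) =
    c • spiralVector θ u f n := by
  have h1 := Real.sin_sq_add_cos_sq (Real.cot θ * Real.log c)
  unfold spiralVector
  rw [Real.log_mul hc.ne' hu.ne', mul_add, Real.cos_add, Real.sin_add]
  set a := Real.cot θ * Real.log c
  set b := Real.cot θ * Real.log u
  linear_combination (norm := module)
    (c * u * Real.sin θ * Real.cos b * h1) • f + (c * u * Real.sin θ * Real.sin b * h1) • n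

/-! ### Surface patches of constant slope -/

/-- `F` is a smooth map of the open plane set `U` to `ℝ³ ∖ {0}` with unit normal `N`, which makes
the angle `θ` with `F`. -/
structure IsSlopePatch (θ : ℝ) (U : Set E2) (F N : E2 → E3) : Prop where
  isOpen : IsOpen U
  smooth : ContDiffOn ℝ ∞ F U
  smooth_normal : ContDiffOn ℝ ∞ N U
  ne_zero : ∀ x ∈ U, F x ≠ 0
  norm_normal : ∀ x ∈ U, ‖N x‖ = 1
  orthogonal : ∀ x ∈ U, ∀ w, inner ℝ (N x) (fderiv ℝ F x w) = 0
  inner_eq : ∀ x ∈ U, inner ℝ (N x) (F x) = ‖F x‖ * Real.cos θ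

namespace IsSlopePatch

variable {θ : ℝ} {U : Set E2} {F N : E2 → E3}

/-- A patch of constant slope is written by a parallel frame as a spiral. -/
theorem exists_frame (h : IsSlopePatch θ U F N) (hθ : 0 < Real.sin θ) :
    ∃ (u : E2 → ℝ) (f n : E2 → E3), IsParallelFrame U f n ∧ ContDiffOn ℝ ∞ u U ∧
      (∀ x ∈ U, 0 < u x) ∧ ∀ x ∈ U, F x = spiralVector θ (u x) (f x) (n x) := by
  -- `e'` is found by solving `N = cos θ e - sin θ e'`; then `f, n` is the pair `e, e'` turned by
  -- `-ξ`.
  let u : E2 → ℝ := fun x => ‖F x‖ / Real.sin θ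
  let ξ : E2 → ℝ := fun x => Real.cot θ * Real.log (u x)
  let e : E2 → E3 := fun x => ‖F x‖⁻¹ • F x
  let e' : E2 → E3 := fun x => (Real.sin θ)⁻¹ • (Real.cos θ • e x - N x)
  let f : E2 → E3 := fun x => Real.cos (ξ x) • e x - Real.sin (ξ x) • e' x
  let n : E2 → E3 := fun x => Real.sin (ξ x) • e x + Real.cos (ξ x) • e' x
  have hFpos : ∀ x ∈ U, 0 < ‖F x‖ := fun x hx => norm_pos_iff.2 (h.ne_zero x hx)
  have hpos : ∀ x ∈ U, 0 < u x := fun x hx => div_pos (hFpos x hx) hθ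
  have hnorm : ContDiffOn ℝ ∞ (fun x => ‖F x‖) U := h.smooth.norm ℝ h.ne_zero
  have hu : ContDiffOn ℝ ∞ u U := hnorm.div_const _
  have hξ : ContDiffOn ℝ ∞ ξ U := contDiffOn_const.mul (hu.log fun x hx => (hpos x hx).ne')
  have he : ContDiffOn ℝ ∞ e U := (hnorm.inv fun x hx => (hFpos x hx).ne').smul h.smooth
  have he' : ContDiffOn ℝ ∞ e' U :=
    ((he.const_smul _).sub h.smooth_normal).const_smul _
  have hf : ContDiffOn ℝ ∞ f U := (hξ.cos.smul he).sub (hξ.sin.smul he')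
  have hn : ContDiffOn ℝ ∞ n U := (hξ.sin.smul he).add (hξ.cos.smul he')
  have hee : ∀ x ∈ U, inner ℝ (e x) (e x) = 1 := fun x hx => by
    have := (hFpos x hx).ne'
    simp only [e, real_inner_self_eq_norm_sq, norm_smul, norm_inv, norm_norm]
    rw [inv_mul_cancel₀ this, one_pow]
  have hNe : ∀ x ∈ U, inner ℝ (N x) (e x) = Real.cos θ := fun x hx => by
    have := (hFpos x hx).ne'
    simp only [e, real_inner_smul_right, h.inner_eq x hx]
    field_simp
  have heN : ∀ x ∈ U, inner ℝ (e x) (N x) = Real.cos θ := fun x hx => by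
    rw [real_inner_comm]; exact hNe x hx
  have hNN : ∀ x ∈ U, inner ℝ (N x) (N x) = 1 := fun x hx => by
    rw [real_inner_self_eq_norm_sq, h.norm_normal x hx]; norm_num
  have hee' : ∀ x ∈ U, inner ℝ (e x) (e' x) = 0 := fun x hx => by
    simp only [e', real_inner_smul_right, inner_sub_right, hee x hx, heN x hx]
    ring
  have he'e : ∀ x ∈ U, inner ℝ (e' x) (e x) = 0 := fun x hx => by
    rw [real_inner_comm]; exact hee' x hx
  have he'e' : ∀ x ∈ U, inner ℝ (e' x) (e' x) = 1 := fun x hx => by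
    simp only [e', real_inner_smul_left, real_inner_smul_right, inner_sub_left, inner_sub_right,
      hee x hx, heN x hx, hNe x hx, hNN x hx]
    have h1 := Real.sin_sq_add_cos_sq θ
    field_simp
    linarith
  have hff : ∀ x ∈ U, inner ℝ (f x) (f x) = 1 := fun x hx => by
    simp only [f, inner_sub_left, inner_sub_right, real_inner_smul_left, real_inner_smul_right,
      hee x hx, hee' x hx, he'e x hx, he'e' x hx]
    linarith [Real.sin_sq_add_cos_sq (ξ x)]
  have hnn : ∀ x ∈ U, inner ℝ (n x) (n x) = 1 := fun x hx => by
    simp only [n, inner_add_left, inner_add_right, real_inner_smul_left, real_inner_smul_right,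
      hee x hx, hee' x hx, he'e x hx, he'e' x hx]
    linarith [Real.sin_sq_add_cos_sq (ξ x)]
  have hfn : ∀ x ∈ U, inner ℝ (f x) (n x) = 0 := fun x hx => by
    simp only [f, n, inner_sub_left, inner_add_right, real_inner_smul_left, real_inner_smul_right,
      hee x hx, hee' x hx, he'e x hx, he'e' x hx]
    ring
  have hnf : ∀ x ∈ U, inner ℝ (n x) (f x) = 0 := fun x hx => by
    rw [real_inner_comm]; exact hfn x hx
  have norm_one : ∀ y : E3, inner ℝ y y = 1 → ‖y‖ = 1 := fun y hy => by
    rw [real_inner_self_eq_norm_sq] at hy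
    rwa [← sq_eq_sq₀ (norm_nonneg _) zero_le_one, one_pow]
  have he_eq : ∀ x, e x = Real.cos (ξ x) • f x + Real.sin (ξ x) • n x := fun x => by
    have h1 := Real.sin_sq_add_cos_sq (ξ x)
    simp only [f, n]
    linear_combination (norm := module) (-h1) • e x
  have he'_eq : ∀ x, e' x = -Real.sin (ξ x) • f x + Real.cos (ξ x) • n x := fun x => by
    have h1 := Real.sin_sq_add_cos_sq (ξ x)
    simp only [f, n]
    linear_combination (norm := module) (-h1) • e' x
  have hN_eq : ∀ x, N x = Real.cos θ • e x - Real.sin θ • e' x := fun x => by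
    simp only [e', smul_smul, mul_inv_cancel₀ hθ.ne', one_smul, sub_sub_cancel]
  have hF : ∀ x ∈ U, F x = spiralVector θ (u x) (f x) (n x) := fun x hx => by
    change F x = (u x * Real.sin θ) • (Real.cos (ξ x) • f x + Real.sin (ξ x) • n x)
    rw [← he_eq x]
    simp only [u, e, smul_smul]
    rw [div_mul_cancel₀ _ hθ.ne', mul_inv_cancel₀ (hFpos x hx).ne', one_smul]
  refine ⟨u, f, n, ⟨h.isOpen, hf, hn, fun x hx => norm_one _ (hff x hx),
    fun x hx => norm_one _ (hnn x hx), hfn, fun x hx w => ?_⟩, hu, hpos, hF⟩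
  have hxU : U ∈ nhds x := h.isOpen.mem_nhds hx
  have hev : ∀ᶠ y in nhds x, y ∈ U := hxU
  have hud := ((hu.contDiffAt hxU).differentiableAt (by simp)).hasFDerivAt
  have hfd := ((hf.contDiffAt hxU).differentiableAt (by simp)).hasFDerivAt
  have hnd := ((hn.contDiffAt hxU).differentiableAt (by simp)).hasFDerivAt
  obtain ⟨L, hL, hLw⟩ := hasFDerivAt_spiralVector hθ.ne' hud hfd hnd (hpos x hx).ne'
  have h1 : fderiv ℝ F x = L := (hL.congr_of_eventuallyEq (hev.mono hF)).fderiv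
  have h2 := h.orthogonal x hx w
  rw [h1, hLw] at h2
  change inner ℝ (N x) (fderiv ℝ u x w • (Real.sin θ • (Real.cos (ξ x) • f x +
    Real.sin (ξ x) • n x) + Real.cos θ • (-Real.sin (ξ x) • f x + Real.cos (ξ x) • n x)) +
    (u x * Real.sin θ) • (Real.cos (ξ x) • fderiv ℝ f x w +
      Real.sin (ξ x) • fderiv ℝ n x w)) = 0 at h2
  have i1 := inner_eq_zero_of_norm_eq hfd (hev.mono fun y hy => norm_one _ (hff y hy)) w
  have i2 := inner_eq_zero_of_norm_eq hnd (hev.mono fun y hy => norm_one _ (hnn y hy)) w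
  have i3 := inner_add_inner_eq_zero_of_inner_eq hfd hnd (hev.mono hfn) w
  rw [real_inner_comm (n x)] at i3
  rw [hN_eq x, he_eq x, he'_eq x] at h2
  simp only [inner_add_left, inner_sub_left, inner_add_right, real_inner_smul_left,
    real_inner_smul_right, hff x hx, hnn x hx, hfn x hx, hnf x hx, i1, i2,
    eq_neg_of_add_eq_zero_left i3] at h2
  have hsc := Real.sin_sq_add_cos_sq (ξ x)
  -- The `du` terms cancel. In the rest, `⟨f, dn⟩ = -⟨n, df⟩` removes the component along `e` and
  -- leaves `⟨n, df⟩` along `e'`.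
  have h3 : u x * Real.sin θ ^ 2 * inner ℝ (n x) (fderiv ℝ f x w) = 0 := by
    linear_combination -h2 - (u x * Real.sin θ ^ 2 * inner ℝ (n x) (fderiv ℝ f x w)) * hsc
  rw [real_inner_comm]
  have h4 : u x * Real.sin θ ^ 2 ≠ 0 := by have := hpos x hx; positivity
  exact (mul_eq_zero.1 h3).resolve_left h4

end IsSlopePatch

/-- A linear functional on the plane has a nonzero kernel. -/
theorem exists_ne_zero_apply_eq_zero (l : E2 →L[ℝ] ℝ) : ∃ w : E2, w ≠ 0 ∧ l w = 0 := by
  by_contra! H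
  have h1 : Function.Injective (l : E2 →ₗ[ℝ] ℝ) := by
    rw [injective_iff_map_eq_zero]
    exact fun w hw => by_contra fun h0 => H w h0 hw
  have := LinearMap.finrank_le_finrank_of_injective h1
  simp at this

/-- The combination of `df` and `dn` which an immersion does not kill. -/
theorem IsParallelFrame.cos_smul_add_sin_smul_ne_zero {U : Set E2} {f n : E2 → E3}
    (h : IsParallelFrame U f n) {θ : ℝ} (hθ : Real.sin θ ≠ 0) {u : E2 → ℝ} {F : E2 → E3}
    (hu : ContDiffOn ℝ ∞ u U) (hpos : ∀ x ∈ U, 0 < u x)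
    (hF : ∀ x ∈ U, F x = spiralVector θ (u x) (f x) (n x)) {p : E2} (hp : p ∈ U)
    (himm : Function.Injective (fderiv ℝ F p)) :
    Real.cos (Real.cot θ * Real.log (u p)) • fderiv ℝ f p +
      Real.sin (Real.cot θ * Real.log (u p)) • fderiv ℝ n p ≠ 0 := by
  intro h0
  have hud := ((hu.contDiffAt (h.isOpen.mem_nhds hp)).differentiableAt (by simp)).hasFDerivAt
  obtain ⟨L, hL, hLw⟩ := hasFDerivAt_spiralVector hθ hud (h.hasFDerivAt_fst hp)
    (h.hasFDerivAt_snd hp) (hpos p hp).ne'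
  have h4 : fderiv ℝ F p = L :=
    (hL.congr_of_eventuallyEq ((h.eventually_mem hp).mono hF)).fderiv
  -- On the kernel of `du`, the derivative of `F` is a multiple of the combination assumed to be
  -- zero.
  obtain ⟨w, hw, hw0⟩ := exists_ne_zero_apply_eq_zero (fderiv ℝ u p)
  refine hw (himm ?_)
  have h5 := congrArg (fun L : E2 →L[ℝ] E3 => L w) h0
  simp only [add_apply, smul_apply, zero_apply] at h5
  rw [map_zero, h4, hLw, h5, hw0]
  simp

namespace IsSlopePatch

variable {θ : ℝ} {U : Set E2} {F N : E2 → E3}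

/-- The factor `c` fails only if `cos δ df = sin δ dn` at `p`, where `δ = cot θ log c`. Two such
equations, with angles `α` and `β`, have determinant `± sin (α - β)`; if it is nonzero, then `df =
dn = 0`, which the immersion forbids. -/
theorem hasSlopeCoordinates_smul_or (h : IsSlopePatch θ U F N) (hθ : 0 < Real.sin θ) {p : E2}
    (hp : p ∈ U) (himm : Function.Injective (fderiv ℝ F p)) {a b : ℝ} (ha : 0 < a) (hb : 0 < b)
    (hab : ∀ k : ℤ, Real.cot θ * (Real.log a - Real.log b) ≠ k * Real.pi) :
    HasSlopeCoordinates θ U (fun x => a • F x) p ∨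
      HasSlopeCoordinates θ U (fun x => b • F x) p := by
  obtain ⟨u, f, n, hfr, hu, hpos, hF⟩ := h.exists_frame hθ
  have hFd : HasFDerivAt F (fderiv ℝ F p) p :=
    ((h.smooth.contDiffAt (h.isOpen.mem_nhds hp)).differentiableAt (by simp)).hasFDerivAt
  have hrot : ∀ δ : ℝ, fderiv ℝ (fun x => Real.cos δ • f x - Real.sin δ • n x) p =
      Real.cos δ • fderiv ℝ f p - Real.sin δ • fderiv ℝ n p := fun δ =>
    (((hfr.hasFDerivAt_fst hp).const_smul (Real.cos δ)).sub
      ((hfr.hasFDerivAt_snd hp).const_smul (Real.sin δ))).fderiv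
  have main : ∀ c : ℝ, 0 < c → Real.cos (Real.cot θ * Real.log c) • fderiv ℝ f p -
      Real.sin (Real.cot θ * Real.log c) • fderiv ℝ n p ≠ 0 →
      HasSlopeCoordinates θ U (fun x => c • F x) p := by
    intro c hc hne
    refine (hfr.rotate (Real.cot θ * Real.log c)).exists_slope_coordinates hθ.ne'
      (u := fun x => c * u x) (F := fun x => c • F x) (contDiffOn_const.mul hu) (fun x hx => mul_pos hc (hpos x hx))
      (fun x hx => ?_) hp ?_ (by rwa [hrot])
    · rw [spiralVector_rotate hc (hpos x hx), ← hF x hx]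
    · have h1 : fderiv ℝ (fun x => c • F x) p = _ := (hFd.const_smul c).fderiv
      rw [h1]
      intro w w' hww
      exact himm (smul_right_injective E3 hc.ne' hww)
  have hne := hfr.cos_smul_add_sin_smul_ne_zero hθ.ne' hu hpos hF hp himm
  by_contra! H
  have hA := not_imp_not.2 (main a ha) H.1
  have hB := not_imp_not.2 (main b hb) H.2
  rw [not_not] at hA hB
  have hs : Real.sin (Real.cot θ * Real.log a - Real.cot θ * Real.log b) ≠ 0 := by
    rw [← mul_sub]
    intro h0
    obtain ⟨k, hk⟩ := Real.sin_eq_zero_iff.1 h0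
    exact hab k hk.symm
  rw [Real.sin_sub] at hs
  set α := Real.cot θ * Real.log a
  set β := Real.cot θ * Real.log b
  have h1 : (Real.sin α * Real.cos β - Real.cos α * Real.sin β) • fderiv ℝ f p = 0 := by
    linear_combination (norm := module) (-Real.sin β) • hA + Real.sin α • hB
  have h2 : (Real.sin α * Real.cos β - Real.cos α * Real.sin β) • fderiv ℝ n p = 0 := by
    linear_combination (norm := module) (-Real.cos β) • hA + Real.cos α • hB
  have smul_cancel : ∀ L : E2 →L[ℝ] E3,
      (Real.sin α * Real.cos β - Real.cos α * Real.sin β) • L = 0 → ∀ w, L w = 0 :=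
    fun L hL w => (smul_eq_zero.1 (DFunLike.congr_fun hL w)).resolve_left hs
  refine hne (ContinuousLinearMap.ext fun w => ?_)
  simp only [add_apply, smul_apply, smul_cancel _ h1 w, smul_cancel _ h2 w, smul_zero, add_zero,
    zero_apply]

/-- Here `ξ = 0`, so the combination that an immersion keeps nonzero is `df` itself. -/
theorem hasSlopeCoordinates_of_cot_eq_zero (h : IsSlopePatch θ U F N) (hθ : 0 < Real.sin θ)
    (hcot : Real.cot θ = 0) {p : E2} (hp : p ∈ U) (himm : Function.Injective (fderiv ℝ F p)) :
    HasSlopeCoordinates θ U F p := by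
  obtain ⟨u, f, n, hfr, hu, hpos, hF⟩ := h.exists_frame hθ
  have hne := hfr.cos_smul_add_sin_smul_ne_zero hθ.ne' hu hpos hF hp himm
  refine hfr.exists_slope_coordinates hθ.ne' hu hpos hF hp himm ?_
  refine fun h0 => hne (ContinuousLinearMap.ext fun w => ?_)
  simp [hcot, h0]

end IsSlopePatch

section Charts

variable {S : Type*} [TopologicalSpace S] [ChartedSpace E2 S]
  {φ : OpenPartialHomeomorph S E2} {r N : S → E3}

/-! ### Reading maps in a chart -/

theorem contDiffOn_comp_chart_symm (hφ : φ ∈ IsManifold.maximalAtlas (𝓡 2) ∞ S)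
    (hr : ContMDiff (𝓡 2) 𝓘(ℝ, E3) ∞ r) : ContDiffOn ℝ ∞ (r ∘ φ.symm) φ.target :=
  contMDiffOn_iff_contDiffOn.1
    (hr.comp_contMDiffOn (contMDiffOn_symm_of_mem_maximalAtlas hφ))

theorem hasFDerivAt_comp_chart_symm (hφ : φ ∈ IsManifold.maximalAtlas (𝓡 2) ∞ S)
    (hr : ContMDiff (𝓡 2) 𝓘(ℝ, E3) ∞ r) {x : E2} (hx : x ∈ φ.target) :
    HasFDerivAt (r ∘ φ.symm) (fderiv ℝ (r ∘ φ.symm) x) x :=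
  (((contDiffOn_comp_chart_symm hφ hr).contDiffAt
    (φ.open_target.mem_nhds hx)).differentiableAt (by simp)).hasFDerivAt

theorem mdifferentiable_of_mem_maximalAtlas (hφ : φ ∈ IsManifold.maximalAtlas (𝓡 2) ∞ S) :
    φ.MDifferentiable (𝓡 2) (𝓡 2) :=
  ⟨(contMDiffOn_of_mem_maximalAtlas hφ).mdifferentiableOn (by simp),
    (contMDiffOn_symm_of_mem_maximalAtlas hφ).mdifferentiableOn (by simp)⟩

theorem fderiv_comp_chart_symm (hφ : φ ∈ IsManifold.maximalAtlas (𝓡 2) ∞ S)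
    (hr : ContMDiff (𝓡 2) 𝓘(ℝ, E3) ∞ r) {x : E2} (hx : x ∈ φ.target) (w : E2) :
    fderiv ℝ (r ∘ φ.symm) x w =
      mfderiv (𝓡 2) 𝓘(ℝ, E3) r (φ.symm x) (mfderiv (𝓡 2) (𝓡 2) φ.symm x w) := by
  rw [← mfderiv_eq_fderiv]
  exact mfderiv_comp_apply x ((hr _).mdifferentiableAt (by simp))
    ((mdifferentiable_of_mem_maximalAtlas hφ).mdifferentiableAt_symm hx) w

theorem IsSurfaceImmersion.injective_fderiv (hr : IsSurfaceImmersion r)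
    (hφ : φ ∈ IsManifold.maximalAtlas (𝓡 2) ∞ S) {x : E2} (hx : x ∈ φ.target) :
    Function.Injective (fderiv ℝ (r ∘ φ.symm) x) := by
  intro w w' h
  rw [fderiv_comp_chart_symm hφ hr.smooth hx, fderiv_comp_chart_symm hφ hr.smooth hx] at h
  exact (mdifferentiable_of_mem_maximalAtlas hφ).symm.mfderiv_injective hx
    (hr.injective_mfderiv _ h)

theorem IsUnitNormal.inner_fderiv (hN : IsUnitNormal r N)
    (hr : ContMDiff (𝓡 2) 𝓘(ℝ, E3) ∞ r) (hφ : φ ∈ IsManifold.maximalAtlas (𝓡 2) ∞ S) {x : E2}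
    (hx : x ∈ φ.target) (w : E2) :
    inner ℝ (N (φ.symm x)) (fderiv ℝ (r ∘ φ.symm) x w) = 0 := by
  rw [fderiv_comp_chart_symm hφ hr hx]
  exact hN.orthogonal _ _

/-! ### From constant slope to the parametrization -/

theorem angle_eq_iff_inner_eq {x y : E3} (hx : ‖x‖ = 1) (hy : y ≠ 0) {θ : ℝ}
    (h0 : 0 ≤ θ) (hπ : θ ≤ Real.pi) :
    InnerProductGeometry.angle x y = θ ↔ inner ℝ x y = ‖y‖ * Real.cos θ := by
  have hy' : ‖y‖ ≠ 0 := norm_ne_zero_iff.2 hy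
  constructor
  · intro h
    have := InnerProductGeometry.cos_angle_mul_norm_mul_norm x y
    rw [h, hx] at this
    linarith
  · intro h
    rw [InnerProductGeometry.angle, h, hx, one_mul, mul_div_cancel_left₀ _ hy',
      Real.arccos_cos h0 hπ]

theorem isSlopePatch_of_angle (hr : IsSurfaceImmersion r) (h0 : ∀ p, r p ≠ 0)
    (hN : IsUnitNormal r N) {θ : ℝ} (hθ : θ ∈ Icc 0 Real.pi)
    (hang : ∀ p, InnerProductGeometry.angle (N p) (r p) = θ)
    (hφ : φ ∈ IsManifold.maximalAtlas (𝓡 2) ∞ S) :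
    IsSlopePatch θ φ.target (r ∘ φ.symm) (N ∘ φ.symm) where
  isOpen := φ.open_target
  smooth := contDiffOn_comp_chart_symm hφ hr.smooth
  smooth_normal := contDiffOn_comp_chart_symm hφ hN.smooth
  ne_zero _ _ := h0 _
  norm_normal _ _ := hN.norm_eq_one _
  orthogonal _ hx w := hN.inner_fderiv hr.smooth hφ hx w
  inner_eq _ _ := (angle_eq_iff_inner_eq (hN.norm_eq_one _) (h0 _) hθ.1 hθ.2).1 (hang _)

variable [IsManifold (𝓡 2) ∞ S]

/-- If `ν` is a vector and `⟨ν, r⟩` has a critical point at `p` in the chart at `p`, then `ν` is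
orthogonal to the surface at `p`. -/
theorem inner_mfderiv_eq_zero (hr : ContMDiff (𝓡 2) 𝓘(ℝ, E3) ∞ r) (p : S) (ν : E3)
    (h : ∀ w, inner ℝ ν (fderiv ℝ (r ∘ (chartAt E2 p).symm) (chartAt E2 p p) w) = 0)
    (w : TangentSpace (𝓡 2) p) :
    inner ℝ ν (mfderiv (𝓡 2) 𝓘(ℝ, E3) r p w : E3) = 0 := by
  have hφ : chartAt E2 p ∈ IsManifold.maximalAtlas (𝓡 2) ∞ S := IsManifold.chart_mem_maximalAtlas p
  have hx := mem_chart_target E2 p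
  have hpp : (chartAt E2 p).symm (chartAt E2 p p) = p :=
    (chartAt E2 p).left_inv (mem_chart_source E2 p)
  -- The tangent space depends on its base point, so `p` is replaced by `φ.symm (φ p)` in the whole
  -- quantified statement, including the type of `w`.
  suffices H : ∀ w : TangentSpace (𝓡 2) ((chartAt E2 p).symm (chartAt E2 p p)), inner ℝ ν
      (mfderiv (𝓡 2) 𝓘(ℝ, E3) r ((chartAt E2 p).symm (chartAt E2 p p)) w : E3) = 0 by
    rw [hpp] at H
    exact H w
  intro w
  obtain ⟨w', rfl⟩ := (mdifferentiable_of_mem_maximalAtlas hφ).symm.mfderiv_surjective hx w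
  exact (congrArg (inner ℝ ν) (fderiv_comp_chart_symm hφ hr hx w')).symm.trans (h w')

theorem HasSlopeCoordinates.hasSlopeParam {θ : ℝ} (hφ : φ ∈ IsManifold.maximalAtlas (𝓡 2) ∞ S)
    {p : S} (hp : p ∈ φ.source) (h : HasSlopeCoordinates θ φ.target (r ∘ φ.symm) (φ p)) :
    HasSlopeParam θ r p := by
  obtain ⟨J, g, ψ, hg, hpψ, hsub, hψ, hψs, hval⟩ := h
  have hψ' : ContMDiffOn (𝓡 2) (𝓡 2) ∞ ψ ψ.source := contMDiffOn_iff_contDiffOn.2 hψ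
  have hψs' : ContMDiffOn (𝓡 2) (𝓡 2) ∞ ψ.symm ψ.target := contMDiffOn_iff_contDiffOn.2 hψs
  refine ⟨J, g, φ.trans ψ, hg, ?_, ?_, ?_, ?_, ?_⟩
  · apply OpenPartialHomeomorph.mem_maximalAtlas_of_contMDiffOn
    · rw [OpenPartialHomeomorph.trans_source]
      exact hψ'.comp ((contMDiffOn_of_mem_maximalAtlas hφ).mono inter_subset_left)
        fun x hx => hx.2
    · rw [OpenPartialHomeomorph.trans_target]
      exact (contMDiffOn_symm_of_mem_maximalAtlas hφ).comp (hψs'.mono inter_subset_left)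
        fun x hx => hx.2
  · rw [OpenPartialHomeomorph.trans_source]
    exact ⟨hp, hpψ⟩
  · exact fun x hx => (hval x (φ.trans_target ψ ▸ hx).1).1
  · exact fun x hx => (hval x (φ.trans_target ψ ▸ hx).1).2.1
  · exact fun x hx => (hval x (φ.trans_target ψ ▸ hx).1).2.2

theorem HasSlope.hasSlopeParam_smul_or (hr : IsSurfaceImmersion r) (h0 : ∀ p, r p ≠ 0) {θ : ℝ}
    (hθ : θ ∈ Ioo 0 Real.pi) (h : HasSlope r θ) (p : S) {a b : ℝ} (ha : 0 < a) (hb : 0 < b)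
    (hab : ∀ k : ℤ, Real.cot θ * (Real.log a - Real.log b) ≠ k * Real.pi) :
    HasSlopeParam θ (fun q => a • r q) p ∨ HasSlopeParam θ (fun q => b • r q) p := by
  obtain ⟨N, hN, hang⟩ := h
  have hφ : chartAt E2 p ∈ IsManifold.maximalAtlas (𝓡 2) ∞ S := IsManifold.chart_mem_maximalAtlas p
  have hp := mem_chart_source E2 p
  exact ((isSlopePatch_of_angle hr h0 hN (Ioo_subset_Icc_self hθ) hang
    hφ).hasSlopeCoordinates_smul_or (Real.sin_pos_of_mem_Ioo hθ) (mem_chart_target E2 p)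
    (hr.injective_fderiv hφ (mem_chart_target E2 p)) ha hb hab).imp
    (fun H => HasSlopeCoordinates.hasSlopeParam hφ hp H)
    (fun H => HasSlopeCoordinates.hasSlopeParam hφ hp H)

theorem HasSlope.hasSlopeParam_pi_div_two (hr : IsSurfaceImmersion r) (h0 : ∀ p, r p ≠ 0)
    (h : HasSlope r (Real.pi / 2)) (p : S) : HasSlopeParam (Real.pi / 2) r p := by
  obtain ⟨N, hN, hang⟩ := h
  have hφ : chartAt E2 p ∈ IsManifold.maximalAtlas (𝓡 2) ∞ S := IsManifold.chart_mem_maximalAtlas p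
  have hpi := Real.pi_pos
  exact HasSlopeCoordinates.hasSlopeParam hφ (mem_chart_source E2 p)
    ((isSlopePatch_of_angle hr h0 hN ⟨by linarith, by linarith⟩ hang
    hφ).hasSlopeCoordinates_of_cot_eq_zero (by simp) (by simp [Real.cot_eq_cos_div_sin])
    (mem_chart_target E2 p) (hr.injective_fderiv hφ (mem_chart_target E2 p)))

theorem HasSlope.exists_hasSlopeParam_smul (hr : IsSurfaceImmersion r) (h0 : ∀ p, r p ≠ 0)
    {θ : ℝ} (hθ : θ ∈ Ioo 0 Real.pi) (h : HasSlope r θ) (p : S) :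
    ∃ c : ℝ, 0 < c ∧ HasSlopeParam θ (fun q => c • r q) p := by
  by_cases hcot : Real.cot θ = 0
  · have hθ2 : θ = Real.pi / 2 := by
      have hs := (Real.sin_pos_of_mem_Ioo hθ).ne'
      have hc : Real.cos θ = 0 := by rw [← sin_mul_cot hs, hcot, mul_zero]
      have := Real.arccos_cos hθ.1.le hθ.2.le
      rw [← this, hc, Real.arccos_zero]
    subst hθ2
    exact ⟨1, one_pos, by simpa using h.hasSlopeParam_pi_div_two hr h0 p⟩
  · have hk : ∀ k : ℤ, Real.cot θ * (Real.log (Real.exp (Real.cot θ)⁻¹) - Real.log 1) ≠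
        k * Real.pi := by
      intro k hk
      rw [Real.log_exp, Real.log_one, sub_zero, mul_inv_cancel₀ hcot] at hk
      have h3 := Real.pi_gt_three
      rcases le_or_gt k 0 with hk0 | hk0
      · have : (k : ℝ) ≤ 0 := by exact_mod_cast hk0
        nlinarith
      · have : (1 : ℝ) ≤ k := by exact_mod_cast hk0
        nlinarith
    rcases h.hasSlopeParam_smul_or hr h0 hθ p (Real.exp_pos _) one_pos hk with h1 | h1
    · exact ⟨_, Real.exp_pos _, h1⟩
    · exact ⟨_, one_pos, h1⟩

end Charts

/-! ### From the parametrization to constant slope -/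

/-- A unit normal of the surface parametrized by `slopeMap θ f` makes the angle `θ` or `π - θ` with
the position vector. -/
theorem inner_sq_eq_of_slopeMap {θ : ℝ} (hθ : 0 < Real.sin θ) {J : Set ℝ} {f : ℝ → E3}
    (hf : IsUnitSpeedSphereCurve J f) {F : E2 → E3} {x : E2} (hx0 : 0 < x 0) (hx1 : x 1 ∈ J)
    (hF : ∀ᶠ y in nhds x, F y = slopeMap θ f (y 0) (y 1))
    (himm : Function.Injective (fderiv ℝ F x)) {ν : E3} (hν : ‖ν‖ = 1)
    (horth : ∀ w, inner ℝ ν (fderiv ℝ F x w) = 0) :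
    inner ℝ ν (F x) ^ 2 = ‖F x‖ ^ 2 * Real.cos θ ^ 2 := by
  have hJ : ∀ t ∈ J, J ∈ nhds t := fun t ht => hf.isOpen.mem_nhds ht
  let n : ℝ → E3 := fun t => cross3 (f t) (deriv f t)
  have hdf : ContDiffOn ℝ ∞ (deriv f) J := hf.smooth.deriv_of_isOpen hf.isOpen (by simp)
  have hn : ContDiffOn ℝ ∞ n J := contDiffOn_cross3 hf.smooth hdf
  have hfd : ∀ t ∈ J, HasFDerivAt f (fderiv ℝ f t) t := fun t ht =>
    ((hf.smooth.contDiffAt (hJ t ht)).differentiableAt (by simp)).hasFDerivAt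
  have hnd : ∀ t ∈ J, HasFDerivAt n (fderiv ℝ n t) t := fun t ht =>
    ((hn.contDiffAt (hJ t ht)).differentiableAt (by simp)).hasFDerivAt
  have hev : ∀ t ∈ J, ∀ᶠ s in nhds t, s ∈ J := fun t ht => hJ t ht
  have hff' : ∀ t ∈ J, inner ℝ (f t) (deriv f t) = 0 := fun t ht =>
    inner_eq_zero_of_norm_eq (hfd t ht) ((hev t ht).mono hf.on_sphere) 1
  have hnorm : ∀ t ∈ J, ‖n t‖ = 1 := fun t ht =>
    norm_cross3_of_orthonormal (hf.on_sphere t ht) (hf.unit_speed t ht) (hff' t ht)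
  have hnn' := inner_eq_zero_of_norm_eq (hnd _ hx1) ((hev _ hx1).mono hnorm) 1
  have hfn' := inner_add_inner_eq_zero_of_inner_eq (hfd _ hx1) (hnd _ hx1)
    ((hev _ hx1).mono fun t _ => inner_self_cross3 (f t) (deriv f t)) 1
  have hnf' : inner ℝ (n (x 1)) (deriv f (x 1)) = 0 := by
    rw [real_inner_comm]; exact inner_cross3_self _ _
  have hff'x := hff' _ hx1
  have hfn : inner ℝ (f (x 1)) (n (x 1)) = 0 := inner_self_cross3 _ _
  rw [fderiv_apply_one_eq_deriv] at hnn' hfn'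
  rw [fderiv_apply_one_eq_deriv, inner_cross3_self, add_zero] at hfn'
  let pr : Fin 2 → E2 →L[ℝ] ℝ := fun i => EuclideanSpace.proj i
  have hfc : HasFDerivAt (fun y : E2 => f (y 1)) ((fderiv ℝ f (x 1)).comp (pr 1)) x :=
    HasFDerivAt.comp (g := f) (f := pr 1) x (hfd _ hx1) (pr 1).hasFDerivAt
  have hnc : HasFDerivAt (fun y : E2 => n (y 1)) ((fderiv ℝ n (x 1)).comp (pr 1)) x :=
    HasFDerivAt.comp (g := n) (f := pr 1) x (hnd _ hx1) (pr 1).hasFDerivAt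
  obtain ⟨L, hL, hLw⟩ := hasFDerivAt_spiralVector (u := fun y : E2 => y 0) hθ.ne'
    (pr 0).hasFDerivAt hfc hnc hx0.ne'
  have hFL : fderiv ℝ F x = L := (hL.congr_of_eventuallyEq hF).fderiv
  have hFx : F x = slopeMap θ f (x 0) (x 1) := hF.self_of_nhds
  rw [slopeMap_eq_spiralVector, spiralVector] at hFx
  rw [hFL] at himm horth
  set ξ := Real.cot θ * Real.log (x 0)
  set a := f (x 1)
  set b := n (x 1)
  set e : E3 := Real.cos ξ • a + Real.sin ξ • b with he
  set e' : E3 := -Real.sin ξ • a + Real.cos ξ • b with he'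
  set X : E3 := (x 0 * Real.sin θ) • (Real.cos ξ • deriv f (x 1) + Real.sin ξ • deriv n (x 1))
    with hX
  have hL0 : L !₂[1, 0] = Real.sin θ • e + Real.cos θ • e' := by
    rw [hLw]; simp [pr, e, e']
  have hL1 : L !₂[0, 1] = X := by
    rw [hLw]
    simp [pr, X]
  -- `X` is the `v`-derivative of the immersion. It is orthogonal to `e` and `e'`, because `f'` and
  -- `n'` are orthogonal to `f` and `n`.
  have hX0 : X ≠ 0 := by
    intro h0
    rw [← hL1] at h0
    have h1 := congrArg (fun z : E2 => z 1) (himm (h0.trans (map_zero L).symm))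
    simp at h1
  have haa : inner ℝ a a = 1 := by
    rw [real_inner_self_eq_norm_sq, hf.on_sphere _ hx1]; norm_num
  have hbb : inner ℝ b b = 1 := by
    rw [real_inner_self_eq_norm_sq, hnorm _ hx1]; norm_num
  have hba : inner ℝ b a = 0 := by rw [real_inner_comm]; exact hfn
  have hsc := Real.sin_sq_add_cos_sq ξ
  have norm_one : ∀ y : E3, inner ℝ y y = 1 → ‖y‖ = 1 := fun y hy => by
    rw [real_inner_self_eq_norm_sq] at hy
    rwa [← sq_eq_sq₀ (norm_nonneg _) zero_le_one, one_pow]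
  have hee : ‖e‖ = 1 := norm_one _ <| by
    simp only [e, inner_add_left, inner_add_right, real_inner_smul_left, real_inner_smul_right,
      haa, hbb, hba, hfn]
    linarith
  have hee' : ‖e'‖ = 1 := norm_one _ <| by
    simp only [e', inner_add_left, inner_add_right, real_inner_smul_left, real_inner_smul_right,
      haa, hbb, hba, hfn]
    linarith
  have heo : inner ℝ e e' = 0 := by
    simp only [e, e', inner_add_left, inner_add_right, real_inner_smul_left,
      real_inner_smul_right, haa, hbb, hba, hfn]
    ring
  have heX : inner ℝ e X = 0 := by
    simp only [e, X, inner_add_left, inner_add_right, real_inner_smul_left,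
      real_inner_smul_right, hff'x, hnf', hnn', hfn']
    ring
  have heX' : inner ℝ e' X = 0 := by
    simp only [e', X, inner_add_left, inner_add_right, real_inner_smul_left,
      real_inner_smul_right, hff'x, hnf', hnn', hfn']
    ring
  have hXn : ‖‖X‖⁻¹ • X‖ = 1 := by
    rw [norm_smul, norm_inv, norm_norm, inv_mul_cancel₀ (norm_ne_zero_iff.2 hX0)]
  have hpars := norm_sq_of_orthonormal_triple hee hee' hXn heo
    (by rw [real_inner_smul_right, heX, mul_zero])
    (by rw [real_inner_smul_right, heX', mul_zero]) ν
  have hνX : inner ℝ (‖X‖⁻¹ • X) ν = 0 := by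
    rw [real_inner_smul_left, real_inner_comm, ← hL1, horth, mul_zero]
  have hν0 := horth !₂[1, 0]
  rw [hL0, inner_add_right, real_inner_smul_right, real_inner_smul_right, real_inner_comm e ν,
    real_inner_comm e' ν] at hν0
  rw [hν, hνX] at hpars
  -- In the plane of `e, e'` the unit vector `ν` is orthogonal to `sin θ e + cos θ e'`, hence equals
  -- `±(cos θ e - sin θ e')`.
  have hcos : inner ℝ e ν ^ 2 = Real.cos θ ^ 2 := by
    have h1 := Real.sin_sq_add_cos_sq θ
    linear_combination (inner ℝ e ν) ^ 2 * (-h1) - Real.cos θ ^ 2 * hpars +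
      (Real.sin θ * inner ℝ e ν - Real.cos θ * inner ℝ e' ν) * hν0
  rw [hFx, real_inner_smul_right, real_inner_comm, mul_pow, hcos, norm_smul, hee, mul_one,
    Real.norm_eq_abs, sq_abs]

section Charts

variable {S : Type*} [TopologicalSpace S] [ChartedSpace E2 S] {r N : S → E3}

/-- A local parametrization determines the normal only up to sign, hence the squares. Both sides
scale by `c ^ 2`, so the homothety drops out. -/
theorem HasSlopeParam.inner_sq_eq (hr : IsSurfaceImmersion r) (hN : IsUnitNormal r N) {θ c : ℝ}
    (hθ : 0 < Real.sin θ) (hc : 0 < c) {p : S} (h : HasSlopeParam θ (fun q => c • r q) p) :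
    inner ℝ (N p) (r p) ^ 2 = (‖r p‖ * Real.cos θ) ^ 2 := by
  obtain ⟨J, f, φ, hf, hφ⟩ := h
  have hx : φ p ∈ φ.target := φ.map_source hφ.mem_source
  have hd := (hasFDerivAt_comp_chart_symm hφ.mem_maximalAtlas hr.smooth hx).const_smul c
  have hd' : fderiv ℝ (fun y => c • (r ∘ φ.symm) y) (φ p) =
      c • fderiv ℝ (r ∘ φ.symm) (φ p) := hd.fderiv
  have hpp : φ.symm (φ p) = p := φ.left_inv hφ.mem_source
  have key := inner_sq_eq_of_slopeMap hθ hf (F := fun y => c • (r ∘ φ.symm) y) (x := φ p)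
    (ν := N p) (hφ.pos _ hx) (hφ.mem_interval _ hx)
    (Filter.Eventually.mono (φ.open_target.mem_nhds hx) fun y hy => hφ.eq y hy)
    (by
      rw [hd']
      intro w w' hw
      exact hr.injective_fderiv hφ.mem_maximalAtlas hx (smul_right_injective E3 hc.ne' hw))
    (hN.norm_eq_one p)
    (fun w => by
      have h1 := hN.inner_fderiv hr.smooth hφ.mem_maximalAtlas hx w
      rw [hpp] at h1
      rw [hd', smul_apply, real_inner_smul_right, h1, mul_zero])
  simp only [Function.comp_apply, hpp, real_inner_smul_right, norm_smul, Real.norm_eq_abs,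
    abs_of_pos hc] at key
  have hc2 : c ^ 2 ≠ 0 := by positivity
  apply mul_left_cancel₀ hc2
  linear_combination key

theorem IsUnitNormal.neg (hN : IsUnitNormal r N) : IsUnitNormal r (fun p => -N p) where
  smooth := contDiff_neg.contMDiff.comp hN.smooth
  norm_eq_one p := by rw [norm_neg, hN.norm_eq_one]
  orthogonal p w := 
    (inner_neg_left (N p) _).trans (neg_eq_zero.2 (hN.orthogonal p w))

/-- On a connected surface, the sign of the unit normal can be chosen globally. -/
theorem hasSlope_of_inner_sq_eq [ConnectedSpace S] (hr : IsSurfaceImmersion r)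
    (h0 : ∀ p, r p ≠ 0) (hN : IsUnitNormal r N) {θ : ℝ} (hθ : θ ∈ Icc 0 Real.pi)
    (h : ∀ p, inner ℝ (N p) (r p) ^ 2 = (‖r p‖ * Real.cos θ) ^ 2) : HasSlope r θ := by
  -- For a right angle the sign is irrelevant. Otherwise `‖r‖ cos θ` never vanishes, and a
  -- continuous function with the same square is globally `±` it.
  by_cases hc : Real.cos θ = 0
  · refine ⟨N, hN, fun p => ?_⟩
    rw [angle_eq_iff_inner_eq (hN.norm_eq_one p) (h0 p) hθ.1 hθ.2]
    have := h p
    rw [hc, mul_zero, zero_pow two_ne_zero] at this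
    rw [pow_eq_zero_iff two_ne_zero |>.1 this, hc, mul_zero]
  · have hc1 : Continuous fun p => (inner ℝ (N p) (r p) : ℝ) :=
      hN.smooth.continuous.inner hr.smooth.continuous
    have hc2 : Continuous fun p => ‖r p‖ * Real.cos θ :=
      hr.smooth.continuous.norm.mul continuous_const
    rcases isPreconnected_univ.eq_or_eq_neg_of_sq_eq hc1.continuousOn hc2.continuousOn
      (fun p _ => h p) (fun {p} _ => mul_ne_zero (norm_ne_zero_iff.2 (h0 p)) hc) with H | H
    · refine ⟨N, hN, fun p => ?_⟩
      rw [angle_eq_iff_inner_eq (hN.norm_eq_one p) (h0 p) hθ.1 hθ.2]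
      exact H (mem_univ p)
    · refine ⟨_, hN.neg, fun p => ?_⟩
      rw [angle_eq_iff_inner_eq (hN.neg.norm_eq_one p) (h0 p) hθ.1 hθ.2, inner_neg_left]
      have := H (mem_univ p)
      simp only [Pi.neg_apply] at this
      rw [this, neg_neg]

theorem hasSlope_of_hasSlopeParam [ConnectedSpace S] (hr : IsSurfaceImmersion r)
    (h0 : ∀ p, r p ≠ 0) (hN : IsUnitNormal r N) {θ : ℝ} (hθ : θ ∈ Ioo 0 Real.pi)
    (h : ∀ p : S, ∃ c : ℝ, 0 < c ∧ HasSlopeParam θ (fun q => c • r q) p) : HasSlope r θ := by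
  refine hasSlope_of_inner_sq_eq hr h0 hN (Ioo_subset_Icc_self hθ) fun p => ?_
  obtain ⟨c, hc, hp⟩ := h p
  exact hp.inner_sq_eq hr hN (Real.sin_pos_of_mem_Ioo hθ) hc

end Charts

/-! ### Open parts of spheres and planes -/

/-- The open set is the interior of `A ∪ Bᶜ`. -/
theorem isOpenPart_of_eventually {A B : Set E3} (hAB : A ⊆ B)
    (h : ∀ a ∈ A, ∀ᶠ y in nhds a, y ∈ B → y ∈ A) : IsOpenPart A B := by
  refine ⟨{x | ∀ᶠ y in nhds x, y ∈ B → y ∈ A}, isOpen_setOfPred_eventually_nhds, ?_⟩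
  ext x
  exact ⟨fun hx => ⟨h x hx, hAB hx⟩, fun hx => hx.1.self_of_nhds hx.2⟩

/-- The tubular map of an immersion along a transversal field is open. -/
theorem map_nhds_add_smul_normal {F ν : E2 → E3} {x : E2} (hF : ContDiffAt ℝ ∞ F x)
    (hν : ContDiffAt ℝ ∞ ν x) (himm : Function.Injective (fderiv ℝ F x)) (hνx : ν x ≠ 0)
    (horth : ∀ w, inner ℝ (ν x) (fderiv ℝ F x w) = 0) :
    Filter.map (fun z : E2 × ℝ => F z.1 + z.2 • ν z.1) (nhds (x, 0)) = nhds (F x) := by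
  have h1 : HasStrictFDerivAt (fun z : E2 × ℝ => F z.1)
      ((fderiv ℝ F x).comp (ContinuousLinearMap.fst ℝ E2 ℝ)) (x, 0) :=
    HasStrictFDerivAt.comp (g := F) (f := Prod.fst) (x, 0) (hF.hasStrictFDerivAt (by simp))
      hasStrictFDerivAt_fst
  have h2 : HasStrictFDerivAt (fun z : E2 × ℝ => ν z.1)
      ((fderiv ℝ ν x).comp (ContinuousLinearMap.fst ℝ E2 ℝ)) (x, 0) :=
    HasStrictFDerivAt.comp (g := ν) (f := Prod.fst) (x, 0) (hν.hasStrictFDerivAt (by simp))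
      hasStrictFDerivAt_fst
  have h3 : HasStrictFDerivAt (fun z : E2 × ℝ => z.2) (ContinuousLinearMap.snd ℝ E2 ℝ) (x, 0) :=
    hasStrictFDerivAt_snd
  obtain ⟨L, hL, hLw⟩ : ∃ L : E2 × ℝ →L[ℝ] E3,
      HasStrictFDerivAt (fun z : E2 × ℝ => F z.1 + z.2 • ν z.1) L (x, 0) ∧
      ∀ w s, L (w, s) = fderiv ℝ F x w + s • ν x :=
    ⟨_, h1.add (h3.smul h2), fun w s => by simp⟩
  have hinj : Function.Injective (L : E2 × ℝ →ₗ[ℝ] E3) := by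
    rw [injective_iff_map_eq_zero]
    rintro ⟨w, s⟩ hws
    have hws' : fderiv ℝ F x w + s • ν x = 0 := (hLw w s).symm.trans hws
    have h5 := congrArg (inner ℝ (ν x)) hws'
    rw [inner_add_right, horth, real_inner_smul_right, inner_zero_right, zero_add,
      real_inner_self_eq_norm_sq] at h5
    have hs : s = 0 := (mul_eq_zero.1 h5).resolve_right
      (pow_ne_zero 2 (norm_ne_zero_iff.2 hνx))
    rw [hs, zero_smul, add_zero] at hws'
    have hw : w = 0 := himm (hws'.trans (map_zero _).symm)
    rw [hs, hw]; rfl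
  have hsurj : (L : E2 × ℝ →ₗ[ℝ] E3).range = ⊤ := LinearMap.range_eq_top.2
    ((LinearMap.injective_iff_surjective_of_finrank_eq_finrank (by simp)).1 hinj)
  have h5 := hL.map_nhds_eq_of_surj hsurj
  simpa using h5

/-- A plane through the origin has a unit normal vector. -/
theorem exists_unit_normal_of_finrank_eq_two {W : Submodule ℝ E3} (hW : Module.finrank ℝ W = 2) :
    ∃ ν : E3, ‖ν‖ = 1 ∧ ∀ w ∈ W, inner ℝ ν w = 0 := by
  have hne : Wᗮ ≠ ⊥ := by
    rw [Ne, Submodule.orthogonal_eq_bot_iff]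
    rintro rfl
    simp at hW
  obtain ⟨x, hx, hx0⟩ := Submodule.exists_mem_ne_zero_of_ne_bot hne
  refine ⟨‖x‖⁻¹ • x, ?_, fun w hw => ?_⟩
  · rw [norm_smul, norm_inv, norm_norm, inv_mul_cancel₀ (norm_ne_zero_iff.2 hx0)]
  · rw [real_inner_smul_left, real_inner_comm, (Submodule.mem_orthogonal W x).1 hx w hw, mul_zero]

section Charts

variable {S : Type*} [TopologicalSpace S] [ChartedSpace E2 S]
  {φ : OpenPartialHomeomorph S E2} {r N : S → E3}

theorem IsSurfaceImmersion.inner_fderiv_eq_zero_of_subset (hr : IsSurfaceImmersion r)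
    (hφ : φ ∈ IsManifold.maximalAtlas (𝓡 2) ∞ S) {W : Submodule ℝ E3}
    (hW : r '' φ.source ⊆ W) {ν : E3} (hν : ∀ w ∈ W, inner ℝ ν w = 0) {x : E2}
    (hx : x ∈ φ.target) (w : E2) : inner ℝ ν (fderiv ℝ (r ∘ φ.symm) x w) = 0 := by
  have h1 := inner_add_inner_eq_zero_of_inner_eq (hasFDerivAt_const ν x)
    (hasFDerivAt_comp_chart_symm hφ hr.smooth hx) (c := 0)
    (Filter.Eventually.mono (φ.open_target.mem_nhds hx)
      fun y hy => hν _ (hW ⟨_, φ.map_target hy, rfl⟩)) w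
  simpa using h1

/-- A piece of an immersed surface which lies in a plane through the origin is an open part
of the plane. -/
theorem IsSurfaceImmersion.isOpenPart_plane (hr : IsSurfaceImmersion r)
    (hφ : φ ∈ IsManifold.maximalAtlas (𝓡 2) ∞ S) {W : Submodule ℝ E3}
    (hW2 : Module.finrank ℝ W = 2) (hW : r '' φ.source ⊆ W) :
    IsOpenPart (r '' φ.source) W := by
  obtain ⟨ν, hν1, hν⟩ := exists_unit_normal_of_finrank_eq_two hW2
  refine isOpenPart_of_eventually hW ?_
  rintro _ ⟨p, hp, rfl⟩
  have hx : φ p ∈ φ.target := φ.map_source hp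
  have hmap := map_nhds_add_smul_normal (F := r ∘ φ.symm) (ν := fun _ => ν) (x := φ p)
    ((contDiffOn_comp_chart_symm hφ hr.smooth).contDiffAt (φ.open_target.mem_nhds hx))
    contDiffAt_const (hr.injective_fderiv hφ hx) (norm_ne_zero_iff.1 (by rw [hν1]; simp))
    (hr.inner_fderiv_eq_zero_of_subset hφ hW hν hx)
  rw [Function.comp_apply, φ.left_inv hp] at hmap
  rw [← hmap, Filter.eventually_map]
  have hz : ∀ᶠ z in nhds ((φ p, 0) : E2 × ℝ), z.1 ∈ φ.target :=
    continuousAt_fst.eventually (φ.open_target.mem_nhds hx)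
  filter_upwards [hz] with z hz hzW
  -- A nearby point is a surface point plus `z.2 • ν`; lying in the plane forces `z.2 = 0`.
  have hmem : r (φ.symm z.1) ∈ r '' φ.source := ⟨_, φ.map_target hz, rfl⟩
  have h1 := hν _ hzW
  rw [inner_add_right, Function.comp_apply, hν _ (hW hmem), real_inner_smul_right,
    real_inner_self_eq_norm_sq, hν1] at h1
  have h2 : z.2 = 0 := by linarith
  rw [h2, zero_smul, add_zero]
  exact hmem

/-- At `π/2` the cotangent vanishes and the spiral becomes `u f(v)`. The alternative of plane and
cone is the excluded middle, with `isOpenPart_plane` upgrading inclusion in a plane. -/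
theorem isConeOrPlaneAt_iff_hasSlopeParam (hr : IsSurfaceImmersion r) (p : S) :
    IsConeOrPlaneAt r p ↔ HasSlopeParam (Real.pi / 2) r p := by
  have hmap : ∀ f : ℝ → E3, slopeMap (Real.pi / 2) f = fun u v => u • f v := fun f => by
    funext u v
    simp [slopeMap, Real.cot_eq_cos_div_sin]
  constructor
  · rintro ⟨J, f, φ, hf, hφ, -⟩
    exact ⟨J, f, φ, hf, by rwa [hmap]⟩
  · rintro ⟨J, f, φ, hf, hφ⟩
    rw [hmap] at hφ
    refine ⟨J, f, φ, hf, hφ, ?_⟩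
    by_cases H : ∃ W : Submodule ℝ E3, Module.finrank ℝ W = 2 ∧ r '' φ.source ⊆ (W : Set E3)
    · obtain ⟨W, hW2, hW⟩ := H
      exact Or.inl ⟨W, hW2, hr.isOpenPart_plane hφ.mem_maximalAtlas hW2 hW⟩
    · exact Or.inr fun W hW2 hW => H ⟨W, hW2, hW⟩

variable [IsManifold (𝓡 2) ∞ S]

/-- An immersed surface which lies in a sphere about the origin is an open part of the sphere. -/
theorem IsSurfaceImmersion.isOpenPart_sphere (hr : IsSurfaceImmersion r) {R : ℝ} (hR : 0 < R)
    (hS : ∀ p, ‖r p‖ = R) : IsOpenPart (range r) (Metric.sphere 0 R) := by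
  refine isOpenPart_of_eventually ?_ ?_
  · rintro _ ⟨p, rfl⟩
    simpa using hS p
  rintro _ ⟨p, rfl⟩
  set φ := chartAt E2 p
  have hφ : φ ∈ IsManifold.maximalAtlas (𝓡 2) ∞ S := IsManifold.chart_mem_maximalAtlas p
  have hp : p ∈ φ.source := mem_chart_source E2 p
  have hx : φ p ∈ φ.target := φ.map_source hp
  have hcd := (contDiffOn_comp_chart_symm hφ hr.smooth).contDiffAt (φ.open_target.mem_nhds hx)
  have hmap := map_nhds_add_smul_normal hcd hcd (hr.injective_fderiv hφ hx)
    (norm_ne_zero_iff.1 (by rw [Function.comp_apply, hS]; exact hR.ne'))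
    (inner_eq_zero_of_norm_eq (hasFDerivAt_comp_chart_symm hφ hr.smooth hx)
      (Filter.Eventually.of_forall fun y => hS _))
  rw [Function.comp_apply, φ.left_inv hp] at hmap
  rw [← hmap, Filter.eventually_map]
  have hz : ∀ᶠ z in nhds ((φ p, 0) : E2 × ℝ), z.2 ∈ Ioi (-1 : ℝ) :=
    continuousAt_snd.eventually (Ioi_mem_nhds (by simp))
  filter_upwards [hz] with z hz hzS
  -- The transversal field is the position vector, so the tubular map only rescales; `z.2 > -1`
  -- makes the factor positive, and the norm `R` makes it `1`.
  have h1 : (r ∘ φ.symm) z.1 + z.2 • (r ∘ φ.symm) z.1 = (1 + z.2) • r (φ.symm z.1) := by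
    rw [Function.comp_apply, add_smul, one_smul]
  rw [h1] at hzS ⊢
  have hpos : 0 < 1 + z.2 := by have : -1 < z.2 := hz; linarith
  rw [mem_sphere_zero_iff_norm, norm_smul, hS, Real.norm_eq_abs, abs_of_pos hpos] at hzS
  have h2 : 1 + z.2 = 1 := mul_right_cancel₀ hR.ne' (by rw [hzS, one_mul])
  rw [h2, one_smul]
  exact mem_range_self _

/-- If the position vector is normal to a connected surface, its length is constant. -/
theorem exists_norm_eq_of_inner_fderiv_eq_zero [ConnectedSpace S] (hr : IsSurfaceImmersion r)
    (h : ∀ p : S, ∀ x ∈ (chartAt E2 p).target, ∀ w, inner ℝ (r ((chartAt E2 p).symm x))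
      (fderiv ℝ (r ∘ (chartAt E2 p).symm) x w) = 0) : ∃ R, ∀ p, ‖r p‖ = R := by
  have hloc : IsLocallyConstant fun p => ‖r p‖ ^ 2 := by
    rw [IsLocallyConstant.iff_eventually_eq]
    intro p
    have hp := mem_chart_source E2 p
    have hx := mem_chart_target E2 p
    have hsmooth := hr.smooth
    have hφ : chartAt E2 p ∈ IsManifold.maximalAtlas (𝓡 2) ∞ S :=
      IsManifold.chart_mem_maximalAtlas p
    have hps := h p
    generalize chartAt E2 p = φ at hp hx hφ hps
    obtain ⟨ε, hε, hball⟩ := Metric.isOpen_iff.1 φ.open_target _ hx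
    have hd : ∀ x ∈ Metric.ball (φ p) ε,
        HasFDerivAt (fun y => ‖(r ∘ φ.symm) y‖ ^ 2) (0 : E2 →L[ℝ] ℝ) x := by
      intro x hx
      have h1 := (hasFDerivAt_comp_chart_symm hφ hsmooth (hball hx)).norm_sq
      have h2 : 2 • (innerSL ℝ ((r ∘ φ.symm) x)).comp (fderiv ℝ (r ∘ φ.symm) x) = 0 :=
        ContinuousLinearMap.ext fun w => by simp [hps x (hball hx) w]
      rwa [h2] at h1
    have hconst : ∀ x ∈ Metric.ball (φ p) ε,
        ‖(r ∘ φ.symm) x‖ ^ 2 = ‖(r ∘ φ.symm) (φ p)‖ ^ 2 := fun x hx =>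
      Metric.isOpen_ball.is_const_of_fderiv_eq_zero (convex_ball _ _).isPreconnected
        (fun y hy => (hd y hy).differentiableAt.differentiableWithinAt)
        (fun y hy => (hd y hy).fderiv) hx (Metric.mem_ball_self hε)
    have hev : ∀ᶠ q in nhds p, φ q ∈ Metric.ball (φ p) ε :=
      (φ.continuousAt hp).eventually (Metric.ball_mem_nhds _ hε)
    filter_upwards [hev, φ.open_source.mem_nhds hp] with q hq hqs
    have h1 := hconst _ hq
    simpa [φ.left_inv hqs, φ.left_inv hp] using h1
  obtain ⟨p₀⟩ := (inferInstance : Nonempty S)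
  refine ⟨‖r p₀‖, fun p => ?_⟩
  have := hloc.apply_eq_of_isPreconnected isPreconnected_univ (mem_univ p) (mem_univ p₀)
  exact (sq_eq_sq₀ (norm_nonneg _) (norm_nonneg _)).1 this

/-- Angle `0` is equality in Cauchy–Schwarz, so `r = ‖r‖ N` is orthogonal to its own derivative.
Conversely, on a sphere `r / R` is a unit normal. -/
theorem hasSlope_zero_iff [ConnectedSpace S] (hr : IsSurfaceImmersion r) (h0 : ∀ p, r p ≠ 0) :
    HasSlope r 0 ↔ ∃ R : ℝ, 0 < R ∧ IsOpenPart (range r) (Metric.sphere 0 R) := by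
  constructor
  · rintro ⟨N, hN, hang⟩
    have hrN : ∀ p, r p = ‖r p‖ • N p := fun p => by
      have h1 := (angle_eq_iff_inner_eq (hN.norm_eq_one p) (h0 p) le_rfl Real.pi_pos.le).1 (hang p)
      have h2 : inner ℝ (N p) (r p) = ‖N p‖ * ‖r p‖ := by
        rw [h1, hN.norm_eq_one, Real.cos_zero, mul_one, one_mul]
      rw [inner_eq_norm_mul_iff_real, hN.norm_eq_one, one_smul] at h2
      exact h2.symm
    obtain ⟨R, hR⟩ := exists_norm_eq_of_inner_fderiv_eq_zero hr fun p x hx w => by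
      rw [hrN, real_inner_smul_left,
        hN.inner_fderiv hr.smooth (IsManifold.chart_mem_maximalAtlas p) hx, mul_zero]
    obtain ⟨p₀⟩ := (inferInstance : Nonempty S)
    have hR0 : 0 < R := hR p₀ ▸ norm_pos_iff.2 (h0 p₀)
    exact ⟨R, hR0, hr.isOpenPart_sphere hR0 hR⟩
  · rintro ⟨R, hR, O, -, hO⟩
    have hS : ∀ p, ‖r p‖ = R := fun p => by
      have h1 : r p ∈ O ∩ Metric.sphere 0 R := hO ▸ mem_range_self p
      simpa using h1.2
    refine ⟨fun p => R⁻¹ • r p, ⟨?_, ?_, ?_⟩, ?_⟩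
    · exact (contDiff_const_smul R⁻¹).contMDiff.comp hr.smooth
    · intro p
      rw [norm_smul, hS, norm_inv, Real.norm_eq_abs, abs_of_pos hR, inv_mul_cancel₀ hR.ne']
    · intro p w
      refine inner_mfderiv_eq_zero hr.smooth p _ (fun w' => ?_) w
      have hφ : chartAt E2 p ∈ IsManifold.maximalAtlas (𝓡 2) ∞ S :=
        IsManifold.chart_mem_maximalAtlas p
      have h1 := inner_eq_zero_of_norm_eq
        (hasFDerivAt_comp_chart_symm hφ hr.smooth (mem_chart_target E2 p))
        (Filter.Eventually.of_forall fun y => hS _) w'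
      rw [Function.comp_apply, (chartAt E2 p).left_inv (mem_chart_source E2 p)] at h1
      rw [real_inner_smul_left, h1, mul_zero]
    · intro p
      rw [InnerProductGeometry.angle_smul_left_of_pos _ _ (inv_pos.2 hR)]
      exact InnerProductGeometry.angle_self (h0 p)

/-- The constant unit normal of the plane serves as `N`. -/
theorem hasSlope_pi_div_two_of_subset_plane (hr : IsSurfaceImmersion r) {W : Submodule ℝ E3}
    (hW2 : Module.finrank ℝ W = 2) (hW : range r ⊆ W) : HasSlope r (Real.pi / 2) := by
  obtain ⟨ν, hν1, hν⟩ := exists_unit_normal_of_finrank_eq_two hW2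
  refine ⟨fun _ => ν, ⟨contMDiff_const, fun _ => hν1, fun p w => ?_⟩, fun p => ?_⟩
  · exact inner_mfderiv_eq_zero hr.smooth p ν
      (hr.inner_fderiv_eq_zero_of_subset (IsManifold.chart_mem_maximalAtlas p)
        ((image_subset_range _ _).trans hW) hν (mem_chart_target E2 p)) w
  · exact InnerProductGeometry.inner_eq_zero_iff_angle_eq_pi_div_two _ _ |>.1
      (hν _ (hW (mem_range_self p)))

end Charts

/-! ### The classification of surfaces of constant slope -/

theorem theorem1 {S : Type*} [TopologicalSpace S] [T2Space S] [SecondCountableTopology S]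
    [ConnectedSpace S] [ChartedSpace E2 S] [IsManifold (𝓡 2) ∞ S]
    (r : S → E3) (hr : IsSurfaceImmersion r) (h0 : ∀ p : S, r p ≠ 0)
    (hor : ∃ N : S → E3, IsUnitNormal r N) :
    -- the classification
    (IsConstantSlope r ↔
      (∃ R : ℝ, 0 < R ∧ IsOpenPart (range r) (Metric.sphere 0 R)) ∨
      ∃ θ ∈ Ioo (0 : ℝ) Real.pi, ∀ p : S, ∃ c : ℝ, 0 < c ∧
        HasSlopeParam θ (fun q => c • r q) p) ∧
    -- angle by angle
    (HasSlope r 0 ↔ ∃ R : ℝ, 0 < R ∧ IsOpenPart (range r) (Metric.sphere 0 R)) ∧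
    (∀ θ ∈ Ioo (0 : ℝ) Real.pi, HasSlope r θ ↔
      ∀ p : S, ∃ c : ℝ, 0 < c ∧ HasSlopeParam θ (fun q => c • r q) p) ∧
    -- near a given point, the numbers `cot θ log c` of the factors `c` that have to be avoided
    -- are all congruent modulo `π`
    (∀ θ ∈ Ioo (0 : ℝ) Real.pi, HasSlope r θ → ∀ (p : S) (a b : ℝ), 0 < a → 0 < b →
      (∀ k : ℤ, Real.cot θ * (Real.log a - Real.log b) ≠ k * Real.pi) →
      HasSlopeParam θ (fun q => a • r q) p ∨ HasSlopeParam θ (fun q => b • r q) p) ∧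
    -- the right angle: no rescaling is needed, and the surfaces are cones and planes
    (HasSlope r (Real.pi / 2) ↔ ∀ p : S, HasSlopeParam (Real.pi / 2) r p) ∧
    (HasSlope r (Real.pi / 2) ↔ ∀ p : S, IsConeOrPlaneAt r p) ∧
    (∀ W : Submodule ℝ E3, Module.finrank ℝ W = 2 → range r ⊆ (W : Set E3) →
      HasSlope r (Real.pi / 2)) := by
  obtain ⟨N, hN⟩ := hor
  have hzero := hasSlope_zero_iff hr h0
  have hangle : ∀ θ ∈ Ioo (0 : ℝ) Real.pi, HasSlope r θ ↔
      ∀ p : S, ∃ c : ℝ, 0 < c ∧ HasSlopeParam θ (fun q => c • r q) p := fun θ hθ =>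
    ⟨fun h p => h.exists_hasSlopeParam_smul hr h0 hθ p, hasSlope_of_hasSlopeParam hr h0 hN hθ⟩
  have hright : HasSlope r (Real.pi / 2) ↔ ∀ p : S, HasSlopeParam (Real.pi / 2) r p := by
    refine ⟨fun h p => h.hasSlopeParam_pi_div_two hr h0 p, fun h => ?_⟩
    have hpi := Real.pi_pos
    exact (hangle _ ⟨by linarith, by linarith⟩).2 fun p => ⟨1, one_pos, by simpa using h p⟩
  refine ⟨⟨?_, ?_⟩, hzero, hangle, fun θ hθ h p a b ha hb hab =>
    h.hasSlopeParam_smul_or hr h0 hθ p ha hb hab, hright,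
    hright.trans (forall_congr' fun p => (isConeOrPlaneAt_iff_hasSlopeParam hr p).symm),
    fun W hW2 hW => hasSlope_pi_div_two_of_subset_plane hr hW2 hW⟩
  · rintro ⟨θ, ⟨hθ0, hθπ⟩, h⟩
    rcases hθ0.eq_or_lt with rfl | hpos
    · exact Or.inl (hzero.1 h)
    · exact Or.inr ⟨θ, ⟨hpos, hθπ⟩, (hangle θ ⟨hpos, hθπ⟩).1 h⟩
  · rintro (h | ⟨θ, hθ, h⟩)
    · exact ⟨0, ⟨le_rfl, Real.pi_pos⟩, hzero.2 h⟩
    · exact ⟨θ, Ioo_subset_Ico_self hθ, (hangle θ hθ).2 h⟩
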